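/- Let $K$ be a field. A ring of axes over $K$ is a reduced $K$-algebra $T$ of finite type and of Krull dimension one whose integral components $\operatorname{Spec} T/\mathfrak p$ ($\mathfrak p$ a minimal prime of $T$) are normal, all pass through one closed point $P$, pairwise meet in no other point, meet transversally at $P$ (their tangent lines at $P$ are linearly independent), and are equal in number to the embedding dimension of $T$ at $P$. For an ideal $I$ of a commutative ring $R$, the ($K$-)axes closure $I^{\rm ax}$ is the ideal of all $f\in R$ such that $\varphi(f)\in\varphi(I)T$ for every ring homomorphism $\varphi:R\to T$ to a ring of axes $T$ over $K$. Theorem. Let $m\ge 0$ and let $I$ be a primary monomial ideal of $R=K[z_1,\ldots,z_m]$. Let $\Gamma=\{\gamma\in\mathbb N^m: z^\gamma\in I\}$, let $\overline\Gamma\subseteq\mathbb R_{\ge 0}^m$ be the convex hull of $\Gamma$, and let $\overline\Gamma^{\circ}$ be the interior of $\overline\Gamma$ as a subset of the topological space $\mathbb R_{\ge 0}^m$ (with the subspace topology). Then $$I^{\rm ax}=I+\bigl(z^\tau:\ \tau\in\mathbb N^m\cap\overline\Gamma^{\circ}\bigr),$$ and a monomial $z^\tau$ belongs to $I^{\rm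 ax}$ if and only if $z^\tau\in I$ or $\tau\in\overline\Gamma^{\circ}$. In particular, if $\tau\in\mathbb N^m$ lies in $\overline\Gamma\setminus\overline\Gamma^{\circ}$ and $z^\tau\notin I$, then $z^\tau\notin I^{\rm ax}$. -/

import Mathlib

open MvPolynomial

universe u v

/-- `P` is the origin of the affine scheme `Spec T`, as in a scheme of axes. The integral components
of `Spec T` are the closed subschemes `Spec (T ⧸ p)`, `p` a minimal prime. -/
structure IsOriginOfAxes (T : Type u) [CommRing T] (P : Ideal T) : Prop where
  /-- The origin is a closed point. -/
  isMaximal : P.IsMaximal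
  /-- Every component passes through the origin. -/
  le_origin : ∀ p ∈ minimalPrimes T, p ≤ P
  /-- Two different components have no other point in common. -/
  meet_only : ∀ p ∈ minimalPrimes T, ∀ q ∈ minimalPrimes T, p ≠ q →
    ∀ Q : Ideal T, Q.IsPrime → p ≤ Q → q ≤ Q → Q = P
  /-- The components meet transversally: no tangent line at `P` lies in the linear span of the
  tangent lines of the other components, i.e. the tangent lines are linearly independent. The
  Zariski tangent space is the dual of `P / P ^ 2`, and in it the tangent space of the component of
  `q` is the annihilator of `(q + P ^ 2) / P ^ 2`; so the cotangent vectors vanishing on the span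
  of the other tangent lines are the classes of `⨅ q ≠ p, (q + P ^ 2)`, and some of them must not
  vanish on the tangent line of `p`. The meet with `P` only matters for a single component. -/
  transversal : ∀ p ∈ minimalPrimes T,
    ¬ P ⊓ (⨅ q ∈ minimalPrimes T \ {p}, q ⊔ P ^ 2) ≤ p ⊔ P ^ 2
  /-- The embedding dimension at `P`, the dimension of `P / P ^ 2` over the residue field of the
  closed point `P`, equals the number of components. -/
  embDim_eq : Module.finrank (T ⧸ P) P.Cotangent = (minimalPrimes T).ncard

/-- `T` is a ring of axes over `K`, i.e. `Spec T` is a scheme of axes over `K`: a one-dimensional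
reduced affine scheme of finite type over `K` with normal integral components that meet
transversally in one closed point, at which the embedding dimension is the number of components. -/
structure IsRingOfAxes (K : Type u) [Field K] (T : Type u) [CommRing T] [Algebra K T] : Prop where
  finiteType : Algebra.FiniteType K T
  isReduced : IsReduced T
  dim_eq_one : ringKrullDim T = 1
  normal : ∀ p ∈ minimalPrimes T, IsIntegrallyClosed (T ⧸ p)
  exists_origin : ∃ P : Ideal T, IsOriginOfAxes T P

/-- The `K`-axes closure of an ideal `I` of a commutative ring `R`: all `f` with
`φ f ∈ φ(I) T` for every ring homomorphism `φ : R → T` to a ring of axes `T` over `K`. Since `T` is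
of finite type over `K`, the universe of `K` suffices for `T`, up to isomorphism. -/
def axesClosure (K : Type u) [Field K] {R : Type v} [CommRing R] (I : Ideal R) : Ideal R where
  carrier := {f | ∀ (T : Type u) [CommRing T] [Algebra K T], IsRingOfAxes K T →
    ∀ φ : R →+* T, φ f ∈ I.map φ}
  add_mem' := fun {a b} ha hb T _ _ hT φ => by
    rw [map_add]
    exact Ideal.add_mem _ (ha T hT φ) (hb T hT φ)
  zero_mem' := fun T _ _ _ φ => by
    rw [map_zero]
    exact Ideal.zero_mem _
  smul_mem' := fun c a ha T _ _ hT φ => by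
    rw [smul_eq_mul, map_mul]
    exact Ideal.mul_mem_left _ _ (ha T hT φ)

/-- A monomial ideal of `K[z_1, …, z_m]`: an ideal generated by monomials. -/
def IsMonomialIdeal {K : Type u} [Field K] {m : ℕ} (I : Ideal (MvPolynomial (Fin m) K)) : Prop :=
  ∃ S : Set (Fin m →₀ ℕ), I = Ideal.span ((fun γ => monomial γ (1 : K)) '' S)

/-- The set `Γ` of exponents of the monomials lying in `I`. -/
def exponentSet {K : Type u} [Field K] {m : ℕ} (I : Ideal (MvPolynomial (Fin m) K)) :
    Set (Fin m →₀ ℕ) :=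
  {γ | monomial γ (1 : K) ∈ I}

/-- An exponent as an integral point of real space. -/
def realPoint {m : ℕ} (γ : Fin m →₀ ℕ) : Fin m → ℝ := fun i => (γ i : ℝ)

/-- The convex hull of the exponent set. -/
def exponentHull {K : Type u} [Field K] {m : ℕ} (I : Ideal (MvPolynomial (Fin m) K)) :
    Set (Fin m → ℝ) :=
  convexHull ℝ (realPoint '' exponentSet I)

/-- The interior of the convex hull of the exponent set as a subset of the topological space
`ℝ_{≥0}^m` (with the subspace topology, so that points on coordinate hyperplanes may be interior).
-/
def exponentHullInterior {K : Type u} [Field K] {m : ℕ} (I : Ideal (MvPolynomial (Fin m) K)) :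
    Set (Fin m → ℝ) :=
  Subtype.val '' interior
    (Subtype.val ⁻¹' exponentHull I : Set (Set.Ici (0 : Fin m → ℝ)))

/-! ### Convex hulls of exponent sets, supporting weights, and their rational approximation. -/

section ConvexGeometry

variable {m : ℕ}

/-! Monomials over the interior lie in the closure because of valuations. Let `φ` map into a ring of
axes with origin `P`, and put `J = φ(I)T`. The components are Dedekind domains, and at each of their
closed points the orders of vanishing of the `φ(z_i)` form a nonnegative weight. A point of the hull
is at least as heavy as some exponent of `I`. If `J ≤ P`, an interior point is strictly heavier for
the weight at the origin, since it can be moved down slightly along a variable vanishing there. So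
on each component the image of the monomial lies in `P * J`, not merely in `J`.

This extra order of vanishing is what gluing needs: transversality gives `P ≤ p ⊔ otherComponents
p`, so the restrictions to the components can be lifted separately into `J` and summed
(`IsOriginOfAxes.le_sup_otherComponents`, `mem_of_forall_mem_sup_mul`). If `J` misses the origin, a
partition of unity reduces to the same argument.

Conversely, after subtracting the allowed monomials from an element of the closure, suppose that a
nonzero remainder `f` is left. Being primary, `I` is generated by monomials in some variables `A`,
among them a power of each; specializing the other variables keeps `f` nonzero. A surviving exponent
has no larger weight than any generator, for a supporting weight that is integral and positive
exactly on `A` (`exists_nat_weight`). The curves `z_i = x_i t ^ w_i`, with `x` running over a large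
finite grid in a finite extension of `K`, together map to a union of axes.

Elements of a ring of axes have one common value at the origin. Hence the lowest coefficients of an
element of the extended ideal are, as functions of `x`, the values of one fixed combination of
generating monomials (`exists_coeff_eq_eval_of_mem_span`). On a large grid this becomes an identity
of polynomials, impossible because the lowest-weight part of `f` contains a monomial that is not a
generator (`eq_zero_of_mem_axesClosure`). -/

lemma realPoint_add (γ δ : Fin m →₀ ℕ) : realPoint (γ + δ) = realPoint γ + realPoint δ := by
  ext i; simp [realPoint]

lemma realPoint_nonneg (γ : Fin m →₀ ℕ) : 0 ≤ realPoint γ := fun i => by simp [realPoint]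

/-- Being interior to the hull relative to the orthant, in terms of a box around the point. -/
lemma realPoint_mem_exponentHullInterior_iff {K : Type u} [Field K]
    {I : Ideal (MvPolynomial (Fin m) K)} {τ : Fin m →₀ ℕ} :
    realPoint τ ∈ exponentHullInterior I ↔
      ∃ ε > 0, ∀ x : Fin m → ℝ, 0 ≤ x → (∀ i, |x i - τ i| < ε) → x ∈ exponentHull I := by
  have key : realPoint τ ∈ exponentHullInterior I ↔
      (⟨realPoint τ, realPoint_nonneg τ⟩ : Set.Ici (0 : Fin m → ℝ)) ∈
        interior (Subtype.val ⁻¹' exponentHull I : Set (Set.Ici (0 : Fin m → ℝ))) := by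
    constructor
    · rintro ⟨x, hx, hxe⟩
      have : x = ⟨realPoint τ, realPoint_nonneg τ⟩ := Subtype.ext hxe
      rwa [← this]
    · intro h
      exact ⟨_, h, rfl⟩
  rw [key, mem_interior_iff_mem_nhds, Metric.mem_nhds_iff]
  constructor
  · rintro ⟨ε, hε, h⟩
    refine ⟨ε, hε, fun x hx hxτ => ?_⟩
    have : (⟨x, hx⟩ : Set.Ici (0 : Fin m → ℝ)) ∈
        Metric.ball (⟨realPoint τ, realPoint_nonneg τ⟩ : Set.Ici (0 : Fin m → ℝ)) ε := by
      rw [Metric.mem_ball, Subtype.dist_eq, dist_pi_lt_iff hε]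
      exact hxτ
    exact h this
  · rintro ⟨ε, hε, h⟩
    refine ⟨ε, hε, fun x hx => h x.1 x.2 ?_⟩
    rw [Metric.mem_ball, Subtype.dist_eq, dist_pi_lt_iff hε] at hx
    exact hx

/-- A linear functional is at most as large at some lattice point as at a given point of the convex
hull, where the lattice point can be taken on the coordinate hyperplanes through that point. -/
lemma exists_mem_sum_le_of_mem_convexHull {Γ : Set (Fin m →₀ ℕ)} {x : Fin m → ℝ}
    (hx : x ∈ convexHull ℝ (realPoint '' Γ)) (Z : Set (Fin m)) (hZ : ∀ i ∈ Z, x i = 0)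
    (v : Fin m → ℝ) :
    ∃ γ ∈ Γ, (∀ i ∈ Z, γ i = 0) ∧ ∑ i, (γ i : ℝ) * v i ≤ ∑ i, x i * v i := by
  by_contra! H
  set c := ∑ i, x i * v i with hc
  -- Under the negated claim `s` contains the lattice points of `Γ` but not `x`. It is convex
  -- because, among nonnegative vectors, a positive coordinate stays positive in a combination with
  -- positive coefficients.
  let s : Set (Fin m → ℝ) := {y | 0 ≤ y ∧ ((∃ i ∈ Z, 0 < y i) ∨ c < ∑ i, y i * v i)}
  have hs : Convex ℝ s := by
    rintro y ⟨hy, hy'⟩ z ⟨hz, hz'⟩ a b ha hb hab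
    rcases ha.eq_or_lt with rfl | ha'
    · obtain rfl : b = 1 := by linarith
      simpa using ⟨hz, hz'⟩
    rcases hb.eq_or_lt with rfl | hb'
    · obtain rfl : a = 1 := by linarith
      simpa using ⟨hy, hy'⟩
    refine ⟨add_nonneg (smul_nonneg ha hy) (smul_nonneg hb hz), ?_⟩
    rcases hy' with ⟨i, hi, hpos⟩ | hy'
    · left
      refine ⟨i, hi, ?_⟩
      simpa using add_pos_of_pos_of_nonneg (mul_pos ha' hpos) (mul_nonneg hb (hz i))
    rcases hz' with ⟨i, hi, hpos⟩ | hz'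
    · left
      refine ⟨i, hi, ?_⟩
      simpa using add_pos_of_nonneg_of_pos (mul_nonneg ha (hy i)) (mul_pos hb' hpos)
    right
    have : ∑ i, (a • y + b • z) i * v i = a * ∑ i, y i * v i + b * ∑ i, z i * v i := by
      rw [Finset.mul_sum, Finset.mul_sum, ← Finset.sum_add_distrib]
      exact Finset.sum_congr rfl fun i _ => by simp; ring
    rw [this]
    calc c = a * c + b * c := by rw [← add_mul, hab, one_mul]
      _ < _ := by gcongr
  have hsub : realPoint '' Γ ⊆ s := by
    rintro _ ⟨γ, hγ, rfl⟩
    refine ⟨realPoint_nonneg γ, ?_⟩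
    by_cases h : ∀ i ∈ Z, γ i = 0
    · exact Or.inr (H γ hγ h)
    · push Not at h
      obtain ⟨i, hi, hne⟩ := h
      exact Or.inl ⟨i, hi, by simpa [realPoint] using Nat.pos_of_ne_zero hne⟩
  obtain ⟨-, ⟨i, hi, hpos⟩ | h⟩ := convexHull_min hsub hs hx
  · exact hpos.ne' (hZ i hi)
  · exact lt_irrefl _ h

/-- The convex hull of an upper set of exponents is stable under adding nonnegative vectors. -/
lemma add_mem_convexHull_of_isUpperSet {Γ : Set (Fin m →₀ ℕ)} (hΓ : IsUpperSet Γ)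
    {x y : Fin m → ℝ} (hx : x ∈ convexHull ℝ (realPoint '' Γ)) (hy : 0 ≤ y) :
    x + y ∈ convexHull ℝ (realPoint '' Γ) := by
  -- The orthant is the hull of all lattice points, and convex hulls commute with Minkowski sums; it
  -- then suffices that `Γ + ℕ^m ⊆ Γ`.
  have h1 : y ∈ convexHull ℝ (realPoint '' (Set.univ : Set (Fin m →₀ ℕ))) := by
    have : (realPoint '' (Set.univ : Set (Fin m →₀ ℕ))) =
        Set.univ.pi fun _ => Set.range ((↑) : ℕ → ℝ) := by
      ext z
      constructor
      · rintro ⟨γ, -, rfl⟩ i -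
        exact ⟨γ i, rfl⟩
      · intro hz
        choose n hn using fun i => hz i (Set.mem_univ i)
        refine ⟨Finsupp.equivFunOnFinite.symm n, trivial, ?_⟩
        ext i
        simp [realPoint, hn]
    rw [this, convexHull_pi]
    intro i _
    have h0 : (0 : ℝ) ∈ Set.range ((↑) : ℕ → ℝ) := ⟨0, by simp⟩
    have h1 : (⌈y i⌉₊ : ℝ) ∈ Set.range ((↑) : ℕ → ℝ) := ⟨_, rfl⟩
    refine segment_subset_convexHull h0 h1 ?_
    rw [segment_eq_Icc (by positivity)]
    exact ⟨hy i, Nat.le_ceil _⟩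
  have h2 := Set.add_mem_add hx h1
  rw [← convexHull_add] at h2
  refine convexHull_mono ?_ h2
  rintro _ ⟨_, ⟨γ, hγ, rfl⟩, _, ⟨δ, -, rfl⟩, rfl⟩
  exact ⟨γ + δ, hΓ le_self_add hγ, realPoint_add γ δ⟩

/-- A nonnegative point outside of the convex hull of an upper set of exponents is separated from
any finite set of exponents by a nonnegative weight. -/
lemma exists_weight_of_notMem_convexHull {Γ : Set (Fin m →₀ ℕ)} (hΓ : IsUpperSet Γ)
    {F : Set (Fin m →₀ ℕ)} (hF : F.Finite) (hFΓ : F ⊆ Γ) {x : Fin m → ℝ} (hx : 0 ≤ x)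
    (hxΓ : x ∉ convexHull ℝ (realPoint '' Γ)) :
    ∃ w : Fin m → ℝ, 0 ≤ w ∧ (∀ γ ∈ F, 1 ≤ ∑ i, (γ i : ℝ) * w i) ∧ ∑ i, x i * w i < 1 := by
  -- Separating from everything below `x`, rather than from `x` alone, forces the normal vector to
  -- have a constant sign.
  have hdisj : Disjoint (convexHull ℝ (realPoint '' F)) (Set.Iic x) := by
    rw [Set.disjoint_left]
    intro c hc hcx
    refine hxΓ ?_
    have := add_mem_convexHull_of_isUpperSet hΓ (convexHull_mono (Set.image_mono hFΓ) hc)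
      (sub_nonneg.2 hcx)
    simpa using this
  obtain ⟨f, s, t, hs, hst, ht⟩ := geometric_hahn_banach_compact_closed (convex_convexHull ℝ _)
    ((hF.image realPoint).isCompact_convexHull ℝ) (convex_Iic x) isClosed_Iic hdisj
  have hf : ∀ y : Fin m → ℝ, f y = ∑ i, y i * f (Pi.single i 1) := by
    intro y
    conv_lhs => rw [← Finset.univ_sum_single y]
    rw [map_sum]
    refine Finset.sum_congr rfl fun i _ => ?_
    rw [← smul_eq_mul, ← map_smul, ← Pi.single_smul, smul_eq_mul, mul_one]
  have hneg : ∀ i, f (Pi.single i 1) ≤ 0 := by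
    intro i
    by_contra! hpos
    have hfx : 0 ≤ f x - t := by linarith [ht x (le_refl x)]
    have hsingle : (0 : Fin m → ℝ) ≤ Pi.single i 1 := Pi.single_nonneg.2 zero_le_one
    have h1 := ht (x - ((f x - t) / f (Pi.single i 1)) • Pi.single i 1)
      (Set.mem_Iic.2 (sub_le_self _ (smul_nonneg (div_nonneg hfx hpos.le) hsingle)))
    rw [map_sub, map_smul, smul_eq_mul, div_mul_cancel₀ _ hpos.ne'] at h1
    linarith
  have hxt := ht x (le_refl x)
  have hfx0 : f x ≤ 0 := by
    rw [hf]
    exact Finset.sum_nonpos fun i _ => mul_nonpos_of_nonneg_of_nonpos (hx i) (hneg i)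
  have ht0 : 0 < -t := by linarith
  -- The separating level `t` is negative, so dividing by it normalizes the level to 1.
  refine ⟨fun i => -f (Pi.single i 1) / -t, fun i => div_nonneg (by simpa using hneg i) ht0.le,
    fun γ hγ => ?_, ?_⟩
  · have h1 := hs _ (subset_convexHull ℝ _ ⟨γ, hγ, rfl⟩)
    rw [hf] at h1
    have h2 : ∑ i, (γ i : ℝ) * (-f (Pi.single i 1) / -t) =
        (-∑ i, realPoint γ i * f (Pi.single i 1)) / -t := by
      rw [← Finset.sum_neg_distrib, Finset.sum_div]
      exact Finset.sum_congr rfl fun i _ => by rw [realPoint]; ring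
    rw [h2, one_le_div ht0]
    linarith
  · have h2 : ∑ i, x i * (-f (Pi.single i 1) / -t) =
        (-∑ i, x i * f (Pi.single i 1)) / -t := by
      rw [← Finset.sum_neg_distrib, Finset.sum_div]
      exact Finset.sum_congr rfl fun i _ => by ring
    rw [h2, div_lt_one ht0, ← hf]
    linarith

/-- A lattice point that is not interior to the convex hull of an upper set of exponents, relative
to the orthant, lies weakly below a supporting hyperplane with nonnegative normal vector that
does not pass through the origin. -/
lemma exists_weight_of_not_interior {Γ : Set (Fin m →₀ ℕ)} (hΓ : IsUpperSet Γ)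
    {F : Set (Fin m →₀ ℕ)} (hF : F.Finite) (hFΓ : F ⊆ Γ) (hF0 : 0 ∉ F) {A : Set (Fin m)}
    (hA : ∀ γ ∈ F, ∀ i ∉ A, γ i = 0) {τ : Fin m →₀ ℕ}
    (hτ : ¬ ∃ ε > 0, ∀ x : Fin m → ℝ, 0 ≤ x → (∀ i, |x i - τ i| < ε) →
      x ∈ convexHull ℝ (realPoint '' Γ)) :
    ∃ w : Fin m → ℝ, 0 ≤ w ∧ (∀ i ∉ A, w i = 0) ∧ (∀ γ ∈ F, 1 ≤ ∑ i, (γ i : ℝ) * w i) ∧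
      ∑ i, (τ i : ℝ) * w i ≤ 1 := by
  classical
  -- The weight is found by minimizing the value at `τ`; the bound by 1 makes the set of competitors
  -- compact.
  let N : Set (Fin m → ℝ) := Set.Icc 0 1 ∩ ({w | ∀ i ∉ A, w i = 0} ∩
    {w | ∀ γ ∈ F, 1 ≤ ∑ i, (γ i : ℝ) * w i})
  have hNc : IsCompact N := by
    refine isCompact_Icc.inter_right (IsClosed.inter ?_ ?_)
    · simp only [Set.ofPred_forall]
      exact isClosed_iInter fun i => isClosed_iInter fun _ =>
        isClosed_eq (continuous_apply i) continuous_const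
    · simp only [Set.ofPred_forall]
      exact isClosed_iInter fun γ => isClosed_iInter fun _ =>
        isClosed_le continuous_const (by fun_prop)
  have hNne : N.Nonempty := by
    refine ⟨A.indicator 1, ⟨fun i => Set.indicator_nonneg (by simp) i,
      fun i => Set.indicator_le_self' (by simp) i⟩, fun i hi => by simp [hi], fun γ hγ => ?_⟩
    have hne : γ ≠ 0 := fun h => hF0 (h ▸ hγ)
    obtain ⟨i, hi⟩ := Finsupp.ne_iff.1 hne
    have hiA : i ∈ A := by_contra fun h => hi (hA γ hγ i h)
    refine le_trans ?_ (Finset.single_le_sum (f := fun i => (γ i : ℝ) * A.indicator 1 i)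
      (fun j _ => mul_nonneg (by positivity) (Set.indicator_nonneg (by simp) j))
      (Finset.mem_univ i))
    simpa [hiA, Nat.one_le_iff_ne_zero] using hi
  obtain ⟨w₀, hw₀, hmin⟩ := hNc.exists_isMinOn hNne
    (f := fun w => ∑ i, (τ i : ℝ) * w i) (by fun_prop)
  refine ⟨w₀, hw₀.1.1, hw₀.2.1, hw₀.2.2, ?_⟩
  by_contra! hlt
  -- If the minimum exceeds 1, the excess is `(m + 1)` times this radius, while moving within the
  -- box lowers the value of a weight in `[0, 1]` by at most `m` times the radius.
  refine hτ ⟨(∑ i, (τ i : ℝ) * w₀ i - 1) / (m + 1), by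
    have : 0 < ∑ i, (τ i : ℝ) * w₀ i - 1 := by linarith
    positivity, fun x hx hxτ => ?_⟩
  by_contra hxΓ
  obtain ⟨w, hw, hwF, hwx⟩ := exists_weight_of_notMem_convexHull hΓ hF hFΓ hx hxΓ
  -- Truncation at 1 keeps the constraints: a coordinate with `w i ≥ 1` occurring in `γ` alone
  -- contributes at least 1, and otherwise nothing is truncated on the support of `γ`.
  let w' : Fin m → ℝ := fun i => if i ∈ A then min (w i) 1 else 0
  have hw'0 : ∀ i, 0 ≤ w' i := fun i => by
    simp only [w']; split_ifs
    · exact le_min (hw i) zero_le_one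
    · exact le_rfl
  have hw'1 : ∀ i, w' i ≤ 1 := fun i => by
    simp only [w']; split_ifs
    · exact min_le_right _ _
    · exact zero_le_one
  have hw'w : ∀ i, w' i ≤ w i := fun i => by
    simp only [w']; split_ifs
    · exact min_le_left _ _
    · exact hw i
  have hw'N : w' ∈ N := by
    refine ⟨⟨hw'0, hw'1⟩, fun i hi => by simp [w', hi], fun γ hγ => ?_⟩
    by_cases h : ∃ i, γ i ≠ 0 ∧ 1 ≤ w i
    · obtain ⟨i, hi, hi1⟩ := h
      have hiA : i ∈ A := by_contra fun h => hi (hA γ hγ i h)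
      refine le_trans ?_ (Finset.single_le_sum (f := fun i => (γ i : ℝ) * w' i)
        (fun j _ => mul_nonneg (by positivity) (hw'0 j)) (Finset.mem_univ i))
      simpa [w', hiA, hi1, Nat.one_le_iff_ne_zero] using hi
    · push Not at h
      refine (hwF γ hγ).trans_eq (Finset.sum_congr rfl fun i _ => ?_)
      by_cases hi : γ i = 0
      · simp [hi]
      · have hiA : i ∈ A := by_contra fun h => hi (hA γ hγ i h)
        simp [w', hiA, (h i hi).le]
  have h1 := hmin hw'N
  simp only [Set.mem_ofPred_eq] at h1
  have h2 : ∑ i, x i * w' i < 1 :=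
    (Finset.sum_le_sum fun i _ => mul_le_mul_of_nonneg_left (hw'w i) (hx i)).trans_lt hwx
  set δ := (∑ i, (τ i : ℝ) * w₀ i - 1) / (m + 1) with hδ
  have hδ0 : 0 < δ := by
    have : 0 < ∑ i, (τ i : ℝ) * w₀ i - 1 := by linarith
    positivity
  have h3 : ∑ i, (τ i : ℝ) * w' i ≤ ∑ i, x i * w' i + m * δ := by
    have : ∑ i, (τ i : ℝ) * w' i ≤ ∑ i, (x i * w' i + δ) := by
      refine Finset.sum_le_sum fun i _ => ?_
      have h := (abs_lt.1 (hxτ i)).1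
      nlinarith [hw'0 i, hw'1 i]
    simpa [Finset.sum_add_distrib] using this
  have h4 : (m + 1) * δ = ∑ i, (τ i : ℝ) * w₀ i - 1 := by
    rw [hδ]; field_simp
  nlinarith

/-- A real vector can be replaced by an integral one without changing the signs of finitely many
integral linear forms. -/
lemma exists_int_sign_eq {ι : Type*} [Fintype ι] (w : ι → ℝ) {B : Set (ι → ℤ)} (hB : B.Finite) :
    ∃ q : ι → ℤ, ∀ a ∈ B, SignType.sign (∑ i, a i * q i) =
      SignType.sign (∑ i, (a i : ℝ) * w i) := by
  classical
  -- In a `ℚ`-basis of the span of the weights, a form vanishing at `w` has zero coordinates. So the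
  -- basis can be perturbed to nearby rationals: zero values stay zero and nonzero values keep their
  -- signs. Clearing denominators finishes.
  let V : Submodule ℚ ℝ := Submodule.span ℚ (Set.range w)
  have hfin : Module.Finite ℚ V := Module.Finite.span_of_finite ℚ (Set.finite_range w)
  let b := Module.finBasis ℚ V
  let w' : ι → V := fun i => ⟨w i, Submodule.subset_span ⟨i, rfl⟩⟩
  let c : (ι → ℤ) → Fin (Module.finrank ℚ V) → ℚ := fun a j => ∑ i, (a i : ℚ) * b.repr (w' i) j
  have hwsum : ∀ i, w i = ∑ j, (b.repr (w' i) j : ℝ) * (b j : ℝ) := by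
    intro i
    have := congrArg (Subtype.val) (b.sum_repr (w' i))
    simp only [Submodule.coe_sum, Submodule.coe_smul] at this
    rw [show w i = (w' i : ℝ) from rfl, ← this]
    exact Finset.sum_congr rfl fun j _ => by rw [Rat.smul_def]
  have hval : ∀ a : ι → ℤ, ∑ i, (a i : ℝ) * w i = ∑ j, (c a j : ℝ) * (b j : ℝ) := by
    intro a
    simp only [c, hwsum, Finset.mul_sum, Rat.cast_sum, Finset.sum_mul, Rat.cast_mul,
      Rat.cast_intCast]
    rw [Finset.sum_comm]
    exact Finset.sum_congr rfl fun j _ => Finset.sum_congr rfl fun i _ => by ring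
  let U : Set (Fin (Module.finrank ℚ V) → ℝ) := ⋂ a ∈ B,
    {r | SignType.sign (∑ i, (a i : ℝ) * w i) ≠ 0 →
      SignType.sign (∑ j, (c a j : ℝ) * r j) = SignType.sign (∑ i, (a i : ℝ) * w i)}
  have hU : U ∈ nhds (fun j => (b j : ℝ)) := by
    refine (Filter.biInter_mem hB).2 fun a _ => ?_
    by_cases h0 : ∑ i, (a i : ℝ) * w i = 0
    · simp [h0]
    have hcont : Continuous fun r : Fin (Module.finrank ℚ V) → ℝ => ∑ j, (c a j : ℝ) * r j := by
      fun_prop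
    rcases lt_or_gt_of_ne h0 with h | h
    · filter_upwards [hcont.continuousAt.eventually_lt continuousAt_const
        (by rwa [← hval] : ∑ j, (c a j : ℝ) * (b j : ℝ) < 0)] with r hr _
      rw [sign_neg hr, sign_neg h]
    · filter_upwards [continuousAt_const.eventually_lt hcont.continuousAt
        (by rwa [← hval] : 0 < ∑ j, (c a j : ℝ) * (b j : ℝ))] with r hr _
      rw [sign_pos hr, sign_pos h]
  obtain ⟨_, hr, ⟨r, rfl⟩⟩ := mem_closure_iff_nhds.1
    ((DenseRange.piMap fun _ : Fin (Module.finrank ℚ V) => Rat.denseRange_cast (𝕜 := ℝ))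
      (fun j => (b j : ℝ))) U hU
  let p : ι → ℚ := fun i => ∑ j, b.repr (w' i) j * r j
  have hp : ∀ a ∈ B, SignType.sign (∑ i, (a i : ℚ) * p i) =
      SignType.sign (∑ i, (a i : ℝ) * w i) := by
    intro a ha
    have hpa : ∑ i, (a i : ℚ) * p i = ∑ j, c a j * r j := by
      simp only [c, p, Finset.mul_sum, Finset.sum_mul]
      rw [Finset.sum_comm]
      exact Finset.sum_congr rfl fun j _ => Finset.sum_congr rfl fun i _ => by ring
    by_cases h0 : ∑ i, (a i : ℝ) * w i = 0
    · have hzero : ∑ i, (a i : ℚ) • w' i = 0 := by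
        apply Subtype.ext
        simp only [Submodule.coe_sum, Submodule.coe_smul, Submodule.coe_zero, w']
        rw [← h0]
        exact Finset.sum_congr rfl fun i _ => by rw [Rat.smul_def]; simp
      have hc0 : ∀ j, c a j = 0 := by
        intro j
        have := congrArg (fun z => b.repr z j) hzero
        simpa [c, Finsupp.finsetSum_apply] using this
      rw [hpa, h0]
      simp [hc0]
    · have := Set.mem_iInter₂.1 hr a ha (by simpa using h0)
      rw [← this, hpa]
      simp only [Pi.map_apply]
      have hcast : ∑ j, (c a j : ℝ) * (r j : ℝ) = ((∑ j, c a j * r j : ℚ) : ℝ) := by push_cast; rfl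
      rw [hcast]
      rcases lt_trichotomy (∑ j, c a j * r j) 0 with h | h | h
      · rw [sign_neg h, sign_neg (by exact_mod_cast h)]
      · rw [h]; simp
      · rw [sign_pos h, sign_pos (by exact_mod_cast h)]
  have hint : ∀ i, ∃ q : ℤ, (q : ℚ) = (∏ j, (p j).den : ℕ) * p i := by
    intro i
    obtain ⟨e, he⟩ := Finset.dvd_prod_of_mem (fun j => (p j).den) (Finset.mem_univ i)
    refine ⟨e * (p i).num, ?_⟩
    rw [he]
    push_cast
    rw [← Rat.mul_den_eq_num (p i)]
    ring
  choose q hq using hint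
  have hpos : (0 : ℚ) < (∏ j, (p j).den : ℕ) := by
    exact_mod_cast Finset.prod_pos fun j _ => (p j).den_pos
  refine ⟨q, fun a ha => ?_⟩
  have hsum : ((∑ i, a i * q i : ℤ) : ℚ) = (∏ j, (p j).den : ℕ) * ∑ i, (a i : ℚ) * p i := by
    rw [Int.cast_sum, Finset.mul_sum]
    refine Finset.sum_congr rfl fun i _ => ?_
    rw [Int.cast_mul, hq]
    ring
  rw [← hp a ha, ← one_mul (SignType.sign (∑ i, (a i : ℚ) * p i)), ← sign_pos hpos, ← sign_mul,
    ← hsum]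
  rcases lt_trichotomy (∑ i, a i * q i) 0 with h | h | h
  · rw [sign_neg h, sign_neg (by exact_mod_cast h)]
  · rw [h]; simp
  · rw [sign_pos h, sign_pos (by exact_mod_cast h)]

end ConvexGeometry

/-! ### Splitting the origin ideal along transversal components. -/

section AxesStructure

variable {T : Type*} [CommRing T]

/-- In an ideal `P` that is principal up to `p` and `P ^ 2`, the powers have the same property. -/
lemma Ideal.pow_le_span_pow_sup {p P : Ideal T} {x : T} (hx : x ∈ P)
    (h : P ≤ Ideal.span {x} ⊔ p ⊔ P ^ 2) {k : ℕ} (hk : 1 ≤ k) :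
    P ^ k ≤ Ideal.span {x ^ k} ⊔ p ⊔ P ^ (k + 1) := by
  induction k, hk using Nat.le_induction with
  | base => simpa using h
  | succ k hk ih =>
    have hspan : Ideal.span {x ^ k} * P ≤ Ideal.span {x ^ (k + 1)} ⊔ p ⊔ P ^ (k + 2) := by
      calc Ideal.span {x ^ k} * P ≤ Ideal.span {x ^ k} * (Ideal.span {x} ⊔ p ⊔ P ^ 2) :=
            Ideal.mul_mono_right h
        _ = Ideal.span {x ^ (k + 1)} ⊔ Ideal.span {x ^ k} * p ⊔ Ideal.span {x ^ k} * P ^ 2 := by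
            rw [Ideal.mul_sup, Ideal.mul_sup, Ideal.span_singleton_mul_span_singleton, ← pow_succ]
        _ ≤ _ := by
            refine sup_le_sup (sup_le_sup le_rfl Ideal.mul_le_right) ?_
            rw [pow_add]
            exact Ideal.mul_mono_left ((Ideal.span_singleton_le_iff_mem _).2
              (Ideal.pow_mem_pow hx k))
    calc P ^ (k + 1) = P ^ k * P := pow_succ _ _
      _ ≤ (Ideal.span {x ^ k} ⊔ p ⊔ P ^ (k + 1)) * P := Ideal.mul_mono_left ih
      _ = Ideal.span {x ^ k} * P ⊔ p * P ⊔ P ^ (k + 2) := by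
          rw [Ideal.sup_mul, Ideal.sup_mul, ← pow_succ]
      _ ≤ _ := sup_le (sup_le hspan
          (Ideal.mul_le_left.trans (le_sup_right.trans le_sup_left))) le_sup_right

/-- The intersection of the other components. -/
abbrev otherComponents (p : Ideal T) : Ideal T := ⨅ q ∈ minimalPrimes T \ {p}, q

lemma otherComponents_le {p q : Ideal T} (hq : q ∈ minimalPrimes T) (h : q ≠ p) :
    otherComponents p ≤ q :=
  iInf₂_le q ⟨hq, h⟩

lemma mem_otherComponents {p : Ideal T} {x : T} :
    x ∈ otherComponents p ↔ ∀ q ∈ minimalPrimes T, q ≠ p → x ∈ q := by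
  simp [otherComponents]

/-- If `x` vanishes modulo an ideal `Q` on all components but `p`, and every element of `Q` can be
split along each component, then `x` is the sum of an element of `p` and one vanishing on the
other components. -/
lemma mem_sup_otherComponents (hfin : (minimalPrimes T).Finite) {Q : Ideal T}
    (hQ : ∀ q ∈ minimalPrimes T, Q ≤ q ⊔ otherComponents q) {p : Ideal T}
    (hp : p ∈ minimalPrimes T) {y : T} (hy : ∀ q ∈ minimalPrimes T, q ≠ p → y ∈ q ⊔ Q) :
    y ∈ p ⊔ otherComponents p := by
  classical
  have h : ∀ q, ∃ d, q ∈ minimalPrimes T → q ≠ p → d ∈ otherComponents q ∧ y - d ∈ q := by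
    intro q
    by_cases hq : q ∈ minimalPrimes T ∧ q ≠ p
    · have h1 := (sup_le le_sup_left (hQ q hq.1) : q ⊔ Q ≤ _) (hy q hq.1 hq.2)
      obtain ⟨a, ha, d, hd, rfl⟩ := Submodule.mem_sup.1 h1
      exact ⟨d, fun _ _ => ⟨hd, by simpa using ha⟩⟩
    · exact ⟨0, fun h1 h2 => absurd ⟨h1, h2⟩ hq⟩
  choose d hd using h
  set s := hfin.toFinset.erase p with hs
  have hmem : ∀ q ∈ s, q ∈ minimalPrimes T ∧ q ≠ p := fun q hq => by
    simpa [hs, and_comm] using hq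
  -- Each `d q` lies in `p` and corrects `y` on `q` without affecting the remaining components.
  rw [← sub_add_cancel y (∑ q ∈ s, d q), add_comm]
  refine Submodule.add_mem_sup (Ideal.sum_mem _ fun q hq => ?_) ?_
  · exact otherComponents_le hp (hmem q hq).2.symm (hd q (hmem q hq).1 (hmem q hq).2).1
  · rw [mem_otherComponents]
    intro r hr hrp
    have hrs : r ∈ s := by simp [hs, hr, hrp]
    rw [← Finset.add_sum_erase _ _ hrs, ← sub_sub]
    refine sub_mem (hd r hr hrp).2 (Ideal.sum_mem _ fun q hq => ?_)
    rw [Finset.mem_erase] at hq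
    exact otherComponents_le hr hq.1.symm (hd q (hmem q hq.2).1 (hmem q hq.2).2).1

/-- The origin ideal of transversal axes splits along each component: locally at the origin, the
scheme is the gluing of its components along the origin. -/
lemma IsOriginOfAxes.le_sup_otherComponents [IsNoetherianRing T] {P : Ideal T}
    (hP : IsOriginOfAxes T P)
    (hded : ∀ p ∈ minimalPrimes T, IsDedekindDomain (T ⧸ p))
    {p : Ideal T} (hp : p ∈ minimalPrimes T) : P ≤ p ⊔ otherComponents p := by
  have hfin := minimalPrimes.finite_of_isNoetherianRing T
  have hPm := hP.isMaximal
  have hx : ∀ p ∈ minimalPrimes T, ∃ x ∈ P, (∀ q ∈ minimalPrimes T, q ≠ p → x ∈ q ⊔ P ^ 2) ∧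
      P ≤ Ideal.span {x} ⊔ p ⊔ P ^ 2 := by
    intro p hp
    obtain ⟨x, hx, hxp⟩ := SetLike.not_le_iff_exists.1 (hP.transversal p hp)
    rw [Ideal.mem_inf] at hx
    refine ⟨x, hx.1, fun q hq hqp => ?_, ?_⟩
    · have := hx.2
      simp only [Ideal.mem_iInf] at this
      exact this q ⟨hq, hqp⟩
    have := hded p hp
    let π := Ideal.Quotient.mk p
    have hπ : Function.Surjective π := Ideal.Quotient.mk_surjective
    have hcomap : ∀ J : Ideal T, (J.map π).comap π = J ⊔ p := fun J => by
      rw [Ideal.comap_map_of_surjective _ hπ, ← RingHom.ker_eq_comap_bot, Ideal.mk_ker]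
    have hprime : (P.map π).IsPrime :=
      Ideal.map_isPrime_of_surjective hπ (by rw [Ideal.mk_ker]; exact hP.le_origin p hp)
    have hlt : (P.map π) ^ 2 < (Ideal.span {x} ⊔ P ^ 2).map π := by
      rw [← Ideal.map_pow]
      refine lt_of_le_not_ge (Ideal.map_mono le_sup_right) fun hle => hxp ?_
      have := Ideal.mem_comap.1 (Ideal.map_le_iff_le_comap.1 hle
        (Ideal.mem_sup_left (Ideal.mem_span_singleton_self x)))
      rw [← Ideal.mem_comap, hcomap, sup_comm] at this
      exact this
    have hne : P.map π ≠ ⊥ := by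
      intro h
      rw [h] at hlt
      have hle : (Ideal.span {x} ⊔ P ^ 2).map π ≤ P.map π := Ideal.map_mono
        (sup_le ((Ideal.span_singleton_le_iff_mem _).2 hx.1) (Ideal.pow_le_self two_ne_zero))
      rw [h] at hle
      exact (hlt.trans_le hle).not_ge bot_le
    -- In a Dedekind domain no ideal lies strictly between a nonzero prime and its square, so `x`
    -- generates `P` modulo `p` and `P ^ 2`.
    have heq := Ideal.eq_prime_pow_of_succ_lt_of_le hne (i := 1) hlt (by
      rw [pow_one]
      exact Ideal.map_mono
        (sup_le ((Ideal.span_singleton_le_iff_mem _).2 hx.1) (Ideal.pow_le_self two_ne_zero)))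
    rw [pow_one] at heq
    have hle : P ≤ (P.map π).comap π := Ideal.le_comap_map
    rw [← heq, hcomap] at hle
    rwa [sup_right_comm]
  -- A prime over `p ⊔ otherComponents p` contains a second component, hence is `P`; so some power
  -- of `P` splits.
  have hpow : ∀ p ∈ minimalPrimes T, ∃ n, P ^ n ≤ p ⊔ otherComponents p := by
    intro p hp
    refine Ideal.exists_pow_le_of_le_radical_of_fg ?_ (IsNoetherian.noetherian P)
    rw [Ideal.radical_eq_sInf]
    refine le_sInf fun Q hQ => ?_
    have hQp := hQ.2
    obtain ⟨q, hq, hqQ⟩ : ∃ q ∈ hfin.toFinset.erase p, q ≤ Q := by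
      refine (hQp.inf_le').1 (le_trans (fun x hx => ?_) (le_sup_right.trans hQ.1))
      rw [mem_otherComponents]
      intro q hq hqp
      exact (Finset.inf_le (f := id) (b := q) (by simp [hq, hqp]) : _ ≤ q) hx
    simp only [Finset.mem_erase, Set.Finite.mem_toFinset] at hq
    exact (hP.meet_only p hp q hq.2 hq.1.symm Q hQp (le_sup_left.trans hQ.1) hqQ).ge
  choose! n hn using hpow
  obtain ⟨N, hN⟩ : ∃ N, ∀ p ∈ minimalPrimes T, P ^ (N + 1) ≤ p ⊔ otherComponents p := by
    refine ⟨hfin.toFinset.sup n, fun p hp => (Ideal.pow_le_pow_right ?_).trans (hn p hp)⟩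
    exact (Finset.le_sup (f := n) (hfin.mem_toFinset.2 hp)).trans (Nat.le_succ _)
  clear hn
  -- Descent on the power: modulo `p` and `P ^ (k + 2)` only `x ^ (k + 1)` is left, and it lies in
  -- `q ⊔ P ^ (k + 2)` on every other component since one factor `x` already lies in `q ⊔ P ^ 2`.
  have hdesc : ∀ k, (∀ p ∈ minimalPrimes T, P ^ (k + 2) ≤ p ⊔ otherComponents p) →
      ∀ p ∈ minimalPrimes T, P ^ (k + 1) ≤ p ⊔ otherComponents p := by
    intro k hk p hp
    obtain ⟨x, hxP, hxq, hxp⟩ := hx p hp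
    refine (Ideal.pow_le_span_pow_sup hxP hxp (Nat.le_add_left 1 k)).trans
      (sup_le (sup_le ?_ le_sup_left) (hk p hp))
    rw [Ideal.span_singleton_le_iff_mem]
    refine mem_sup_otherComponents hfin hk hp fun q hq hqp => ?_
    have h1 : x * x ^ k ∈ (q ⊔ P ^ 2) * P ^ k :=
      Ideal.mul_mem_mul (hxq q hq hqp) (Ideal.pow_mem_pow hxP k)
    rw [← pow_succ' x k, Ideal.sup_mul, ← pow_add, add_comm 2 k] at h1
    exact (sup_le_sup Ideal.mul_le_left le_rfl :
      q * P ^ k ⊔ P ^ (k + 2) ≤ q ⊔ P ^ (k + 2)) h1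
  have hall : ∀ p ∈ minimalPrimes T, P ^ (0 + 1) ≤ p ⊔ otherComponents p := by
    induction N with
    | zero => exact hN
    | succ N ih => exact ih (hdesc N hN)
  simpa using hall p hp

/-- Membership in an ideal of a ring of axes can be tested on the components, up to one order of
vanishing at the origin. -/
lemma mem_of_forall_mem_sup_mul [IsReduced T] (hfin : (minimalPrimes T).Finite) {P J : Ideal T}
    (hP : ∀ p ∈ minimalPrimes T, P ≤ p ⊔ otherComponents p) {f : T}
    (hf : ∀ p ∈ minimalPrimes T, f ∈ p ⊔ P * J) : f ∈ J := by
  classical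
  have h : ∀ p, ∃ d, p ∈ minimalPrimes T → d ∈ otherComponents p ∧ d ∈ J ∧ f - d ∈ p := by
    intro p
    by_cases hp : p ∈ minimalPrimes T
    · have hle : p ⊔ P * J ≤ p ⊔ otherComponents p * J :=
        sup_le le_sup_left ((Ideal.mul_mono_left (hP p hp)).trans (by
          rw [Ideal.sup_mul]
          exact sup_le_sup_right Ideal.mul_le_left _))
      obtain ⟨a, ha, d, hd, rfl⟩ := Submodule.mem_sup.1 (hle (hf p hp))
      exact ⟨d, fun _ => ⟨Ideal.mul_le_left hd, Ideal.mul_le_right hd, by simpa using ha⟩⟩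
    · exact ⟨0, fun h => absurd h hp⟩
  choose d hd using h
  -- The difference vanishes on every component, and in a reduced ring the components meet in zero.
  have hzero : f - ∑ p ∈ hfin.toFinset, d p = 0 := by
    have hbot : sInf (minimalPrimes T) = (⊥ : Ideal T) := by
      rw [minimalPrimes, Ideal.sInf_minimalPrimes]
      exact Ideal.radical_bot_of_isReduced
    rw [← Ideal.mem_bot, ← hbot, Ideal.mem_sInf]
    intro r hr
    rw [← Finset.add_sum_erase _ _ (hfin.mem_toFinset.2 hr), ← sub_sub]
    refine sub_mem (hd r hr).2.2 (Ideal.sum_mem _ fun q hq => ?_)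
    rw [Finset.mem_erase, Set.Finite.mem_toFinset] at hq
    exact otherComponents_le hr hq.1.symm (hd q hq.2).1
  rw [sub_eq_zero.1 hzero]
  exact Ideal.sum_mem _ fun p hp => (hd p (hfin.mem_toFinset.1 hp)).2.1

/-- For an ideal that does not pass through the origin, membership can be tested on the
components. -/
lemma mem_of_forall_mem_sup_of_sup_eq_top [IsReduced T] (hfin : (minimalPrimes T).Finite)
    {P J : Ideal T} (hP : ∀ p ∈ minimalPrimes T, P ≤ p ⊔ otherComponents p) (hJ : J ⊔ P = ⊤)
    {f : T} (hf : ∀ p ∈ minimalPrimes T, f ∈ p ⊔ J) : f ∈ J := by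
  obtain ⟨j, hj, u, hu, hju⟩ := Submodule.mem_sup.1 ((Ideal.eq_top_iff_one _).1 hJ)
  rw [← one_mul f, ← hju, add_mul]
  refine add_mem (Ideal.mul_mem_right _ _ hj) (mem_of_forall_mem_sup_mul hfin hP fun p hp => ?_)
  have h1 : u * f ∈ P * (p ⊔ J) := Ideal.mul_mem_mul hu (hf p hp)
  rw [Ideal.mul_sup] at h1
  exact (sup_le_sup Ideal.mul_le_right le_rfl : P * p ⊔ P * J ≤ p ⊔ P * J) h1

end AxesStructure

/-! ### Orders of vanishing of monomials on a single component. -/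

section Dedekind

/-- The components of a ring of axes are Dedekind domains. -/
lemma IsRingOfAxes.isDedekindDomain {K T : Type u} [Field K] [CommRing T] [Algebra K T]
    (hT : IsRingOfAxes K T) {p : Ideal T} (hp : p ∈ minimalPrimes T) :
    IsDedekindDomain (T ⧸ p) := by
  have := hT.finiteType
  have : IsNoetherianRing T := Algebra.FiniteType.isNoetherianRing K T
  have : p.IsPrime := hp.isPrime
  have hdim : Ring.KrullDimLE 1 (T ⧸ p) := by
    rw [Ring.krullDimLE_iff]
    exact (ringKrullDim_quotient_le p).trans hT.dim_eq_one.le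
  have : Ring.DimensionLEOne (T ⧸ p) :=
    ⟨fun h h' => Ring.krullDimLE_one_iff_of_noZeroDivisors.1 hdim _ h h'⟩
  have := hT.normal p hp
  exact { (inferInstance : IsNoetherianRing (T ⧸ p)), (inferInstance : Ring.DimensionLEOne (T ⧸ p)),
    (inferInstance : IsDomain (T ⧸ p)), (inferInstance : IsIntegrallyClosed (T ⧸ p)) with }

variable {m : ℕ}

/-- The order of a monomial in elements of a discrete valuation ring. -/
lemma addVal_prod_pow {V : Type*} [CommRing V] [IsDomain V] [IsDiscreteValuationRing V]
    (a : Fin m → V) (γ : Fin m →₀ ℕ) (h : ∀ i, a i = 0 → γ i = 0) :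
    IsDiscreteValuationRing.addVal V (∏ i, a i ^ γ i) =
      ((∑ i, γ i * (IsDiscreteValuationRing.addVal V (a i)).toNat : ℕ) : ℕ∞) := by
  have key : ∀ s : Finset (Fin m), IsDiscreteValuationRing.addVal V (∏ i ∈ s, a i ^ γ i) =
      ((∑ i ∈ s, γ i * (IsDiscreteValuationRing.addVal V (a i)).toNat : ℕ) : ℕ∞) := by
    intro s
    induction s using Finset.cons_induction with
    | empty => simp
    | cons i s hi ih =>
      rw [Finset.prod_cons, Finset.sum_cons, IsDiscreteValuationRing.addVal_mul, ih,
        IsDiscreteValuationRing.addVal_pow, Nat.cast_add]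
      congr 1
      -- A zero `a i` has order `⊤`, which `toNat` sends to 0; this is harmless since its exponent
      -- is then 0.
      by_cases h0 : γ i = 0
      · simp [h0]
      · have hne : IsDiscreteValuationRing.addVal V (a i) ≠ ⊤ := fun ht =>
          h0 (h i (IsDiscreteValuationRing.addVal_eq_top_iff.1 ht))
        rw [Nat.cast_mul, ENat.natCast_toNat hne, nsmul_eq_mul]
  exact key _

/-- A monomial in the convex hull is divisible by a monomial of the given set after substitution of
elements of a discrete valuation ring. -/
lemma exists_prod_pow_dvd_of_mem_convexHull {V : Type*} [CommRing V] [IsDomain V]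
    [IsDiscreteValuationRing V] (a : Fin m → V) {Γ : Set (Fin m →₀ ℕ)} {τ : Fin m →₀ ℕ}
    (hτ : realPoint τ ∈ convexHull ℝ (realPoint '' Γ)) :
    ∃ γ ∈ Γ, ∏ i, a i ^ γ i ∣ ∏ i, a i ^ τ i := by
  obtain ⟨γ₀, hγ₀⟩ : Γ.Nonempty := (convexHull_nonempty_iff.1 ⟨_, hτ⟩).of_image
  by_cases h0 : ∃ i, a i = 0 ∧ τ i ≠ 0
  · obtain ⟨i, hi, hτi⟩ := h0
    refine ⟨γ₀, hγ₀, ?_⟩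
    have hz : ∏ i, a i ^ τ i = 0 := Finset.prod_eq_zero (Finset.mem_univ i) (by simp [hi, hτi])
    exact hz ▸ dvd_zero _
  push Not at h0
  obtain ⟨γ, hγ, hγ0, hle⟩ := exists_mem_sum_le_of_mem_convexHull hτ {i | a i = 0}
    (fun i hi => by simp [realPoint, h0 i hi])
    (fun i => ((IsDiscreteValuationRing.addVal V (a i)).toNat : ℝ))
  refine ⟨γ, hγ, ?_⟩
  rw [← IsDiscreteValuationRing.addVal_le_iff_dvd, addVal_prod_pow a γ hγ0, addVal_prod_pow a τ h0]
  simp only [realPoint] at hle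
  exact_mod_cast hle

/-- A monomial interior to the convex hull relative to the orthant is a proper multiple of a
monomial of the given set after substitution of elements of a discrete valuation ring. -/
lemma exists_prod_pow_eq_mul_of_interior {V : Type*} [CommRing V] [IsDomain V]
    [IsDiscreteValuationRing V] (a : Fin m → V) {Γ : Set (Fin m →₀ ℕ)} {τ : Fin m →₀ ℕ}
    (hτ : ∃ ε > 0, ∀ x : Fin m → ℝ, 0 ≤ x → (∀ i, |x i - τ i| < ε) →
      x ∈ convexHull ℝ (realPoint '' Γ))
    (ha : ∀ γ ∈ Γ, ¬ IsUnit (∏ i, a i ^ γ i)) :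
    ∃ γ ∈ Γ, ∃ d, ¬ IsUnit d ∧ ∏ i, a i ^ τ i = d * ∏ i, a i ^ γ i := by
  obtain ⟨ε, hε, hτ⟩ := hτ
  have hτ0 : realPoint τ ∈ convexHull ℝ (realPoint '' Γ) :=
    hτ _ (realPoint_nonneg τ) (by simp [realPoint, hε])
  obtain ⟨γ₀, hγ₀, hdvd⟩ := exists_prod_pow_dvd_of_mem_convexHull a hτ0
  by_cases h0 : ∃ i, a i = 0 ∧ τ i ≠ 0
  · obtain ⟨i, hi, hτi⟩ := h0
    refine ⟨γ₀, hγ₀, 0, not_isUnit_zero, ?_⟩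
    rw [zero_mul, Finset.prod_eq_zero (Finset.mem_univ i) (by rw [hi, zero_pow hτi])]
  push Not at h0
  -- Otherwise the monomial at `τ` is a unit, and so is its divisor at `γ₀`.
  obtain ⟨i, hi, hτi⟩ : ∃ i, ¬ IsUnit (a i) ∧ τ i ≠ 0 := by
    by_contra! H
    refine ha γ₀ hγ₀ (isUnit_of_dvd_unit hdvd ?_)
    rw [IsUnit.prod_univ_iff]
    intro i
    by_cases hi : IsUnit (a i)
    · exact hi.pow _
    · simp [H i hi]
  have hai : a i ≠ 0 := fun h => hτi (h0 i h)
  set v : Fin m → ℕ := fun i => (IsDiscreteValuationRing.addVal V (a i)).toNat with hv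
  have hvi : 0 < v i := by
    rw [Nat.pos_iff_ne_zero, hv]
    simp only [ne_eq, ENat.toNat_eq_zero, not_or]
    exact ⟨fun h => hi (IsDiscreteValuationRing.addVal_eq_zero_iff.1 h),
      fun h => hai (IsDiscreteValuationRing.addVal_eq_top_iff.1 h)⟩
  -- At most `ε / 2` to stay in the box, and at most `1 ≤ τ i` to stay in the orthant.
  set δ : ℝ := min (ε / 2) 1 with hδ
  have hδ0 : 0 < δ := lt_min (by positivity) one_pos
  have hτi1 : (1 : ℝ) ≤ τ i := by exact_mod_cast Nat.one_le_iff_ne_zero.2 hτi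
  have hx := hτ (realPoint τ - Pi.single i δ) (by
      intro j
      by_cases hj : j = i
      · subst hj
        have := (min_le_right (ε / 2) 1).trans hτi1
        simpa only [realPoint, Pi.sub_apply, Pi.single_eq_same, Pi.zero_apply, sub_nonneg] using this
      · simp [realPoint, hj]) (by
      intro j
      by_cases hj : j = i
      · subst hj
        simp only [realPoint, Pi.sub_apply, Pi.single_eq_same, sub_sub_cancel_left, abs_neg,
          abs_of_pos hδ0]
        exact (min_le_left _ _).trans_lt (by linarith)
      · simpa [realPoint, hj] using hε)
  obtain ⟨γ, hγ, hγ0, hle⟩ := exists_mem_sum_le_of_mem_convexHull hx {i | a i = 0}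
    (fun j hj => by
      have : j ≠ i := fun h => hai (h ▸ hj)
      simp [realPoint, h0 j hj, this])
    (fun i => (v i : ℝ))
  have hlt : ∑ j, γ j * v j < ∑ j, τ j * v j := by
    have h1 : ∑ j, (realPoint τ - Pi.single i δ : Fin m → ℝ) j * (v j : ℝ) =
        ∑ j, (τ j : ℝ) * v j - δ * v i := by
      simp only [Pi.sub_apply, sub_mul, Finset.sum_sub_distrib, realPoint]
      congr 1
      rw [Finset.sum_eq_single i (fun j _ hj => by simp [hj]) (by simp)]
      simp
    have h2 : (0 : ℝ) < δ * v i := mul_pos hδ0 (by exact_mod_cast hvi)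
    have h3 : ∑ j, (γ j : ℝ) * v j < ∑ j, (τ j : ℝ) * v j := by linarith
    exact_mod_cast h3
  have hval := addVal_prod_pow a γ hγ0
  have hvalτ := addVal_prod_pow a τ h0
  obtain ⟨d, hd⟩ := IsDiscreteValuationRing.addVal_le_iff_dvd.1
    (show IsDiscreteValuationRing.addVal V (∏ i, a i ^ γ i) ≤
      IsDiscreteValuationRing.addVal V (∏ i, a i ^ τ i) by
        rw [hval, hvalτ]; exact_mod_cast hlt.le)
  refine ⟨γ, hγ, d, fun hu => ?_, by rw [hd, mul_comm]⟩
  rw [hd, IsDiscreteValuationRing.addVal_mul, hval, IsDiscreteValuationRing.addVal_eq_zero_iff.2 hu,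
    add_zero] at hvalτ
  exact hlt.ne (by exact_mod_cast hvalτ)

/-- The local rings at maximal ideals of a Dedekind domain that is not a field. -/
lemma isDiscreteValuationRing_localization_of_ne_bot {D : Type*} [CommRing D]
    [IsDedekindDomain D] {Q P : Ideal D} [Q.IsMaximal] (hP : P.IsMaximal) (hP0 : P ≠ ⊥) :
    IsDiscreteValuationRing (Localization.AtPrime Q) := by
  have hQ : Q ≠ ⊥ := by
    rintro rfl
    have : (⊥ : Ideal D).IsMaximal := inferInstance
    exact hP0 (this.eq_of_le hP.ne_top bot_le).symm
  exact IsLocalization.AtPrime.isDiscreteValuationRing_of_dedekind_domain D hQ _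

/-- Membership is local, and `P ≠ ⊥` makes every localization at a maximal ideal a discrete
valuation ring. -/
lemma prod_pow_mem_of_mem_convexHull {D : Type*} [CommRing D] [IsDedekindDomain D] {P : Ideal D}
    (hP : P.IsMaximal) (hP0 : P ≠ ⊥) (a : Fin m → D) {Γ : Set (Fin m →₀ ℕ)} {τ : Fin m →₀ ℕ}
    (hτ : realPoint τ ∈ convexHull ℝ (realPoint '' Γ)) {J : Ideal D}
    (hJ : ∀ γ ∈ Γ, ∏ i, a i ^ γ i ∈ J) : ∏ i, a i ^ τ i ∈ J := by
  refine Ideal.mem_of_localization_maximal fun Q hQ => ?_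
  have := isDiscreteValuationRing_localization_of_ne_bot (Q := Q) hP hP0
  obtain ⟨γ, hγ, hdvd⟩ := exists_prod_pow_dvd_of_mem_convexHull
    (fun i => algebraMap D (Localization.AtPrime Q) (a i)) hτ
  simp only [← map_pow, ← map_prod] at hdvd
  exact Ideal.mem_of_dvd _ hdvd (Ideal.mem_map_of_mem _ (hJ γ hγ))

/-- Locally at `P` the nonunit cofactor of an interior monomial supplies the factor from `P`; at the
other maximal ideals `P` becomes the unit ideal. -/
lemma prod_pow_mem_mul_of_interior {D : Type*} [CommRing D] [IsDedekindDomain D] {P : Ideal D}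
    (hP : P.IsMaximal) (hP0 : P ≠ ⊥) (a : Fin m → D) {Γ : Set (Fin m →₀ ℕ)} {τ : Fin m →₀ ℕ}
    (hτ : ∃ ε > 0, ∀ x : Fin m → ℝ, 0 ≤ x → (∀ i, |x i - τ i| < ε) →
      x ∈ convexHull ℝ (realPoint '' Γ)) {J : Ideal D}
    (hJ : ∀ γ ∈ Γ, ∏ i, a i ^ γ i ∈ J) (hJP : J ≤ P) : ∏ i, a i ^ τ i ∈ P * J := by
  refine Ideal.mem_of_localization_maximal fun Q hQ => ?_
  have := isDiscreteValuationRing_localization_of_ne_bot (Q := Q) hP hP0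
  have hτ0 : realPoint τ ∈ convexHull ℝ (realPoint '' Γ) := by
    obtain ⟨ε, hε, hτ⟩ := hτ
    exact hτ _ (realPoint_nonneg τ) (by simp [realPoint, hε])
  rw [Ideal.map_mul]
  by_cases hPQ : P = Q
  · subst hPQ
    obtain ⟨γ, hγ, d, hd, heq⟩ := exists_prod_pow_eq_mul_of_interior
      (fun i => algebraMap D (Localization.AtPrime P) (a i)) hτ (fun γ hγ hu => by
        simp only [← map_pow, ← map_prod] at hu
        exact (IsLocalization.AtPrime.isUnit_to_map_iff _ P _).1 hu (hJP (hJ γ hγ)))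
    simp only [← map_pow, ← map_prod] at heq
    rw [heq]
    refine Ideal.mul_mem_mul ?_ (Ideal.mem_map_of_mem _ (hJ γ hγ))
    rw [Localization.AtPrime.map_eq_maximalIdeal]
    exact hd
  · have htop : P.map (algebraMap D (Localization.AtPrime Q)) = ⊤ := by
      obtain ⟨u, huP, huQ⟩ := SetLike.not_le_iff_exists.1 fun h => hPQ (hP.eq_of_le hQ.ne_top h)
      exact Ideal.eq_top_of_isUnit_mem _ (Ideal.mem_map_of_mem _ huP)
        ((IsLocalization.AtPrime.isUnit_to_map_iff _ Q u).2 huQ)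
    rw [htop, Ideal.top_mul]
    exact Ideal.mem_map_of_mem _ (prod_pow_mem_of_mem_convexHull hP hP0 a hτ0 hJ)

end Dedekind

/-! ### Interior monomials belong to the axes closure. -/

section Interior

variable {m : ℕ}

/-- Monomials interior to the convex hull lie in the axes closure. -/
lemma monomial_mem_axesClosure_of_mem_interior {K : Type u} [Field K]
    {I : Ideal (MvPolynomial (Fin m) K)} {τ : Fin m →₀ ℕ}
    (hτ : realPoint τ ∈ exponentHullInterior I) :
    monomial τ (1 : K) ∈ axesClosure K I := by
  intro T _ _ hT φ
  rw [realPoint_mem_exponentHullInterior_iff] at hτ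
  have := hT.finiteType
  have := hT.isReduced
  have : IsNoetherianRing T := Algebra.FiniteType.isNoetherianRing K T
  have hfin := minimalPrimes.finite_of_isNoetherianRing T
  obtain ⟨P, hP⟩ := hT.exists_origin
  have hPm := hP.isMaximal
  have hsplit : ∀ p ∈ minimalPrimes T, P ≤ p ⊔ otherComponents p := fun p hp =>
    hP.le_sup_otherComponents (fun q hq => hT.isDedekindDomain hq) hp
  set J := I.map φ with hJ
  have hmon : ∀ γ : Fin m →₀ ℕ, φ (monomial γ 1) = ∏ i, φ (X i) ^ γ i := fun γ => by
    rw [monomial_eq, C_1, one_mul, Finsupp.prod_fintype _ _ (fun i => pow_zero _), map_prod]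
    simp only [map_pow]
  have hcomap : ∀ p Q : Ideal T, (Q.map (Ideal.Quotient.mk p)).comap (Ideal.Quotient.mk p) =
      p ⊔ Q := fun p Q => by
    rw [Ideal.comap_map_of_surjective _ Ideal.Quotient.mk_surjective,
      ← RingHom.ker_eq_comap_bot, Ideal.mk_ker, sup_comm]
  have hPp : ∀ p ∈ minimalPrimes T, (P.map (Ideal.Quotient.mk p)).IsMaximal ∧
      P.map (Ideal.Quotient.mk p) ≠ ⊥ := by
    intro p hp
    have hle := hP.le_origin p hp
    have hc : (P.map (Ideal.Quotient.mk p)).comap (Ideal.Quotient.mk p) = P := by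
      rw [hcomap, sup_eq_right.2 hle]
    refine ⟨(Ideal.map_eq_top_or_isMaximal_of_surjective _ Ideal.Quotient.mk_surjective
      hPm).resolve_left fun h => ?_, fun h => ?_⟩
    · rw [h, Ideal.comap_top] at hc
      exact hPm.ne_top hc.symm
    · rw [h, ← RingHom.ker_eq_comap_bot, Ideal.mk_ker] at hc
      -- A component reduced to the origin would have no tangent direction, contrary to
      -- transversality.
      refine hP.transversal p hp (inf_le_left.trans ?_)
      rw [← hc]
      exact le_sup_left
  have hJp : ∀ p : Ideal T, ∀ γ ∈ exponentSet I,
      ∏ i, Ideal.Quotient.mk p (φ (X i)) ^ γ i ∈ J.map (Ideal.Quotient.mk p) := by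
    intro p γ hγ
    have h := congrArg (Ideal.Quotient.mk p) (hmon γ)
    rw [map_prod] at h
    simp only [map_pow] at h
    rw [← h]
    exact Ideal.mem_map_of_mem _ (Ideal.mem_map_of_mem _ hγ)
  by_cases hle : J ≤ P
  · refine mem_of_forall_mem_sup_mul hfin hsplit fun p hp => ?_
    have := hT.isDedekindDomain hp
    rw [← hcomap, Ideal.mem_comap, hmon, map_prod, Ideal.map_mul]
    simp only [map_pow]
    exact prod_pow_mem_mul_of_interior (hPp p hp).1 (hPp p hp).2 _ hτ (hJp p) (Ideal.map_mono hle)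
  · refine mem_of_forall_mem_sup_of_sup_eq_top hfin hsplit
      (by rw [sup_comm]; exact hPm.out.2 _ (left_lt_sup.2 hle)) fun p hp => ?_
    have := hT.isDedekindDomain hp
    rw [← hcomap, Ideal.mem_comap, hmon, map_prod]
    simp only [map_pow]
    obtain ⟨ε, hε, hτ⟩ := hτ
    exact prod_pow_mem_of_mem_convexHull (hPp p hp).1 (hPp p hp).2 _
      (hτ _ (realPoint_nonneg τ) (by simp [realPoint, hε])) (hJp p)

end Interior

/-! ### The union of coordinate axes as a ring of axes. -/

section ModelAxes

/-- The dimension of the cotangent space of a maximal ideal with generators that are independent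
modulo its square. -/
lemma Ideal.finrank_cotangent_eq_card {T J : Type*} [CommRing T] [Fintype J] {P : Ideal T}
    [P.IsMaximal] (x : J → T) (hP : P = Ideal.span (Set.range x))
    (hx : ∀ g : J → T, ∑ j, g j * x j ∈ P ^ 2 → ∀ j, g j ∈ P) :
    Module.finrank (T ⧸ P) P.Cotangent = Fintype.card J := by
  let _ := Ideal.Quotient.field P
  have hxP : ∀ j, x j ∈ P := fun j => hP ▸ Ideal.subset_span ⟨j, rfl⟩
  let b : J → P.Cotangent := fun j => P.toCotangent ⟨x j, hxP j⟩
  have hb : ∀ g : J → T, ∑ j, Ideal.Quotient.mk P (g j) • b j =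
      P.toCotangent ⟨∑ j, g j * x j, Ideal.sum_mem _ fun j _ => Ideal.mul_mem_left _ _ (hxP j)⟩ := by
    intro g
    have : (⟨∑ j, g j * x j, Ideal.sum_mem _ fun j _ => Ideal.mul_mem_left _ _ (hxP j)⟩ : P) =
        ∑ j, g j • ⟨x j, hxP j⟩ := by
      apply Subtype.ext
      simp
    rw [this, map_sum]
    refine Finset.sum_congr rfl fun j _ => ?_
    rw [map_smul]
    rfl
  have hli : LinearIndependent (T ⧸ P) b := by
    rw [Fintype.linearIndependent_iff]
    intro c hc j
    choose g hg using fun j => Ideal.Quotient.mk_surjective (c j)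
    simp only [← hg] at hc ⊢
    rw [hb, Ideal.toCotangent_eq_zero] at hc
    exact Ideal.Quotient.eq_zero_iff_mem.2 (hx g hc j)
  have hsp : ⊤ ≤ Submodule.span (T ⧸ P) (Set.range b) := by
    intro y _
    obtain ⟨⟨f, hf⟩, rfl⟩ := P.toCotangent_surjective y
    have hf' := hf
    rw [hP, Ideal.mem_span_range_iff_exists_fun] at hf'
    obtain ⟨g, rfl⟩ := hf'
    rw [← hb]
    exact Submodule.sum_mem _ fun j _ => Submodule.smul_mem _ _ (Submodule.subset_span ⟨j, rfl⟩)
  rw [Module.finrank_eq_card_basis (Module.Basis.mk hli hsp)]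

/-- The coordinate ring of the union of coordinate axes indexed by `J`: families of polynomials in
one variable with a common constant term. -/
noncomputable def axesAlgebra (L : Type*) [Field L] (J : Type*) : Subalgebra L (J → Polynomial L) where
  carrier := {f | ∀ i j, (f i).coeff 0 = (f j).coeff 0}
  mul_mem' := fun {f g} hf hg i j => by
    simp only [Pi.mul_apply, Polynomial.mul_coeff_zero, hf i j, hg i j]
  add_mem' := fun {f g} hf hg i j => by
    simp only [Pi.add_apply, Polynomial.coeff_add, hf i j, hg i j]
  algebraMap_mem' := fun c i j => by simp

namespace axesAlgebra

variable {L : Type*} [Field L] {J : Type*}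

/-- The restriction to one axis. -/
noncomputable def proj (j : J) : axesAlgebra L J →ₐ[L] Polynomial L :=
  (Pi.evalAlgHom L (fun _ : J => Polynomial L) j).comp (axesAlgebra L J).val

lemma proj_apply (j : J) (f : axesAlgebra L J) : proj j f = f.1 j := rfl

lemma ext_proj {f g : axesAlgebra L J} (h : ∀ j, proj j f = proj j g) : f = g :=
  Subtype.ext (funext h)

lemma coeff_zero_proj (f : axesAlgebra L J) (i j : J) :
    (proj i f).coeff 0 = (proj j f).coeff 0 := f.2 i j

/-- The ideal of an axis. -/
noncomputable def axisIdeal (L : Type*) [Field L] {J : Type*} (j : J) : Ideal (axesAlgebra L J) :=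
  RingHom.ker (proj j : axesAlgebra L J →ₐ[L] Polynomial L)

lemma mem_axisIdeal {j : J} {f : axesAlgebra L J} : f ∈ axisIdeal L j ↔ proj j f = 0 :=
  RingHom.mem_ker

instance (j : J) : (axisIdeal L j).IsPrime := RingHom.ker_isPrime _

/-- The value at the origin, computed on one axis. -/
noncomputable def evalOrigin (j : J) : axesAlgebra L J →+* L :=
  (Polynomial.constantCoeff (R := L)).comp (proj j : axesAlgebra L J →ₐ[L] Polynomial L).toRingHom

lemma evalOrigin_apply (j : J) (f : axesAlgebra L J) : evalOrigin j f = (proj j f).coeff 0 := rfl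

/-- The finitely many axis ideals intersect in zero, so a prime contains one of them. -/
lemma exists_axisIdeal_le [Fintype J] {Q : Ideal (axesAlgebra L J)} (hQ : Q.IsPrime) :
    ∃ j, axisIdeal L j ≤ Q := by
  have hbot : Finset.univ.inf (axisIdeal L) ≤ Q := by
    intro f hf
    have : f = 0 := ext_proj fun j => by
      rw [map_zero]
      exact mem_axisIdeal.1 ((Finset.inf_le (Finset.mem_univ j) : _ ≤ axisIdeal L j) hf)
    rw [this]
    exact Q.zero_mem
  obtain ⟨j, -, hj⟩ := hQ.inf_le'.1 hbot
  exact ⟨j, hj⟩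

variable [DecidableEq J]

/-- The coordinate function of an axis. -/
noncomputable def coord (j : J) : axesAlgebra L J :=
  ⟨Pi.single j Polynomial.X, fun i k => by
    have h : ∀ i, ((Pi.single j Polynomial.X : J → Polynomial L) i).coeff 0 = 0 := fun i => by
      by_cases h : i = j
      · subst h; simp
      · simp [h]
    rw [h, h]⟩

@[simp] lemma proj_coord_self (j : J) : proj j (coord j : axesAlgebra L J) = Polynomial.X := by
  simp [proj_apply, coord]

lemma proj_coord_of_ne {i j : J} (h : i ≠ j) : proj i (coord j : axesAlgebra L J) = 0 := by
  simp [proj_apply, coord, h]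

@[simp] lemma proj_aeval_coord_self (j : J) (g : Polynomial L) :
    proj j (Polynomial.aeval (coord j : axesAlgebra L J) g) = g := by
  rw [← Polynomial.aeval_algHom_apply, proj_coord_self, Polynomial.aeval_X_left_apply]

lemma proj_surjective (j : J) : Function.Surjective (proj j : axesAlgebra L J → Polynomial L) :=
  fun g => ⟨_, proj_aeval_coord_self j g⟩

lemma coord_mem_axisIdeal {i j : J} (h : i ≠ j) : (coord j : axesAlgebra L J) ∈ axisIdeal L i :=
  mem_axisIdeal.2 (proj_coord_of_ne h)

lemma coord_notMem_axisIdeal (j : J) : (coord j : axesAlgebra L J) ∉ axisIdeal L j := by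
  rw [mem_axisIdeal, proj_coord_self]
  exact Polynomial.X_ne_zero

lemma axisIdeal_injective : Function.Injective (axisIdeal L : J → Ideal (axesAlgebra L J)) := by
  intro i j h
  by_contra hne
  exact coord_notMem_axisIdeal j (h ▸ coord_mem_axisIdeal hne)

lemma isIntegrallyClosed_quotient (j : J) :
    IsIntegrallyClosed (axesAlgebra L J ⧸ axisIdeal L j) :=
  IsIntegrallyClosed.of_equiv (Ideal.quotientKerAlgEquivOfSurjective
    (proj_surjective (L := L) j)).symm.toRingEquiv

variable [Fintype J]

/-- Elements that vanish at the origin are combinations of the coordinate functions. -/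
lemma eq_sum_mul_coord {f : axesAlgebra L J} (hf : ∀ j, (proj j f).coeff 0 = 0) :
    f = ∑ j, Polynomial.aeval (coord j) (proj j f).divX * coord j := by
  refine ext_proj fun i => ?_
  rw [map_sum, Finset.sum_eq_single i]
  · rw [map_mul, proj_aeval_coord_self, proj_coord_self]
    conv_lhs => rw [← Polynomial.divX_mul_X_add (proj i f), hf i, Polynomial.C_0, add_zero]
  · intro j _ hj
    rw [map_mul, proj_coord_of_ne hj.symm, mul_zero]
  · simp

/-- The ideal of the origin. -/
noncomputable def origin (L : Type*) [Field L] (J : Type*) [DecidableEq J] [Fintype J] :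
    Ideal (axesAlgebra L J) := Ideal.span (Set.range coord)

lemma mem_origin_iff {f : axesAlgebra L J} :
    f ∈ origin L J ↔ ∀ j, (proj j f).coeff 0 = 0 := by
  constructor
  · intro hf j
    have hle : origin L J ≤ RingHom.ker (evalOrigin j) := by
      refine Ideal.span_le.2 ?_
      rintro _ ⟨i, rfl⟩
      rw [SetLike.mem_coe, RingHom.mem_ker, evalOrigin_apply]
      by_cases h : j = i
      · subst h
        simp
      · simp [proj_coord_of_ne h]
    exact hle hf
  · intro h
    rw [eq_sum_mul_coord h]
    exact Ideal.sum_mem _ fun j _ => Ideal.mul_mem_left _ _ (Ideal.subset_span ⟨j, rfl⟩)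

lemma coord_mem_origin (j : J) : (coord j : axesAlgebra L J) ∈ origin L J :=
  Ideal.subset_span ⟨j, rfl⟩

lemma minimalPrimes_eq : minimalPrimes (axesAlgebra L J) = Set.range (axisIdeal L) := by
  ext p
  constructor
  · intro hp
    obtain ⟨j, hj⟩ := exists_axisIdeal_le hp.isPrime
    exact ⟨j, le_antisymm hj (hp.2 ⟨inferInstance, bot_le⟩ hj)⟩
  · rintro ⟨j, rfl⟩
    refine ⟨⟨inferInstance, bot_le⟩, fun Q hQ hle => ?_⟩
    obtain ⟨i, hi⟩ := exists_axisIdeal_le hQ.1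
    by_cases h : i = j
    · exact h ▸ hi
    · exact absurd (hle (hi (coord_mem_axisIdeal h))) (coord_notMem_axisIdeal j)

lemma axisIdeal_le_origin (j : J) : axisIdeal L j ≤ origin L J := by
  intro f hf
  rw [mem_origin_iff]
  intro i
  rw [coeff_zero_proj f i j, mem_axisIdeal.1 hf, Polynomial.coeff_zero]

lemma origin_isMaximal [Nonempty J] : (origin L J).IsMaximal := by
  let j : J := Classical.arbitrary J
  have h : origin L J = RingHom.ker (evalOrigin j) := by
    ext f
    rw [mem_origin_iff, RingHom.mem_ker, evalOrigin_apply]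
    exact ⟨fun h => h j, fun h i => (coeff_zero_proj f i j).trans h⟩
  rw [h]
  refine RingHom.ker_isMaximal_of_surjective _ fun c => ⟨algebraMap L _ c, ?_⟩
  rw [evalOrigin_apply, AlgHom.commutes]
  simp

lemma finiteType (K : Type*) [Field K] [Algebra K L] [Module.Finite K L] [Nonempty J] :
    Algebra.FiniteType K (axesAlgebra L J) := by
  have : Algebra.FiniteType L (axesAlgebra L J) := by
    refine ⟨Subalgebra.fg_def.2 ⟨Set.range coord, Set.finite_range _, ?_⟩⟩
    refine eq_top_iff.2 fun f _ => ?_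
    let j₀ : J := Classical.arbitrary J
    have hf := eq_sum_mul_coord (f := f - algebraMap L _ ((proj j₀ f).coeff 0)) (fun j => by
      simp [coeff_zero_proj f j j₀])
    rw [sub_eq_iff_eq_add] at hf
    rw [hf]
    refine add_mem (sum_mem fun j _ => mul_mem ?_ ?_) (Subalgebra.algebraMap_mem _ _)
    · exact Algebra.adjoin_mono (Set.singleton_subset_iff.2 (Set.mem_range_self j))
        (Polynomial.aeval_mem_adjoin_singleton _ _)
    · exact Algebra.subset_adjoin ⟨j, rfl⟩
  have : Algebra.FiniteType K L := inferInstance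
  exact Algebra.FiniteType.trans (S := L) ‹_› ‹_›

/-- A prime strictly above an axis ideal corresponds to a nonzero prime of `L[X]`, hence is maximal;
and the origin is strictly above each axis ideal. -/
lemma ringKrullDim_eq_one [Nonempty J] : ringKrullDim (axesAlgebra L J) = 1 := by
  refine le_antisymm ?_ ?_
  · have : Ring.KrullDimLE 1 (axesAlgebra L J) := by
      rw [Ring.krullDimLE_one_iff]
      intro Q hQ
      obtain ⟨j, hj⟩ := exists_axisIdeal_le hQ
      by_cases hjQ : Q = axisIdeal L j
      · left
        rw [minimalPrimes_eq]
        exact ⟨j, hjQ.symm⟩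
      right
      have hsurj := proj_surjective (L := L) j
      have hc : (Q.map (proj j)).comap (proj j) = Q := by
        rw [Ideal.comap_map_of_surjective _ hsurj]
        exact sup_eq_left.2 hj
      have hprime : (Q.map (proj j)).IsPrime := Ideal.map_isPrime_of_surjective hsurj hj
      have hne : Q.map (proj j) ≠ ⊥ := by
        intro h
        rw [h] at hc
        exact hjQ hc.symm
      have hmax : (Q.map (proj j)).IsMaximal := hprime.isMaximal hne
      rw [← hc]
      exact Ideal.comap_isMaximal_of_surjective _ hsurj
    exact_mod_cast Ring.krullDimLE_iff.1 this
  · by_contra h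
    have h0 : Ring.KrullDimLE 0 (axesAlgebra L J) := by
      rw [Ring.krullDimLE_iff]
      exact (ENat.WithBot.lt_add_one_iff (m := 0)).1 (by simpa using h)
    let j : J := Classical.arbitrary J
    have hmax : (axisIdeal L j).IsMaximal := Ring.krullDimLE_zero_iff.1 h0 _ inferInstance
    have heq := hmax.eq_of_le (origin_isMaximal (L := L) (J := J)).ne_top (axisIdeal_le_origin j)
    exact coord_notMem_axisIdeal j (heq ▸ coord_mem_origin j)

/-- Linear coefficients along the axes detect cotangent vectors; this gives both the embedding
dimension and transversality. -/
lemma coeff_one_proj_of_mem_sq {f : axesAlgebra L J} (hf : f ∈ origin L J ^ 2) (j : J) :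
    (proj j f).coeff 1 = 0 := by
  rw [pow_two] at hf
  refine Submodule.mul_induction_on hf (fun a ha b hb => ?_) (fun a b ha hb => ?_)
  · rw [map_mul, Polynomial.mul_coeff_one, mem_origin_iff.1 ha, mem_origin_iff.1 hb]
    simp
  · rw [map_add, Polynomial.coeff_add, ha, hb, add_zero]

lemma finrank_cotangent [Nonempty J] :
    Module.finrank (axesAlgebra L J ⧸ origin L J) (origin L J).Cotangent = Fintype.card J := by
  have := origin_isMaximal (L := L) (J := J)
  refine Ideal.finrank_cotangent_eq_card coord rfl fun g hg j => ?_
  have h1 := coeff_one_proj_of_mem_sq hg j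
  rw [map_sum, Finset.sum_eq_single j, map_mul, proj_coord_self, Polynomial.coeff_mul_X] at h1
  · rw [mem_origin_iff]
    exact fun i => (coeff_zero_proj _ i j).trans h1
  · intro i _ hi
    rw [map_mul, proj_coord_of_ne hi.symm, mul_zero]
  · simp

lemma isOriginOfAxes [Nonempty J] : IsOriginOfAxes (axesAlgebra L J) (origin L J) where
  isMaximal := origin_isMaximal
  le_origin := by
    rw [minimalPrimes_eq]
    rintro _ ⟨j, rfl⟩
    exact axisIdeal_le_origin j
  meet_only := by
    rw [minimalPrimes_eq]
    rintro _ ⟨i, rfl⟩ _ ⟨j, rfl⟩ hne Q hQ hi hj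
    refine ((origin_isMaximal (L := L) (J := J)).eq_of_le hQ.ne_top (Ideal.span_le.2 ?_)).symm
    rintro _ ⟨k, rfl⟩
    by_cases h : i = k
    · exact hj (coord_mem_axisIdeal (by rintro rfl; exact hne (by rw [h])))
    · exact hi (coord_mem_axisIdeal h)
  transversal := by
    rw [minimalPrimes_eq]
    rintro _ ⟨j, rfl⟩ hle
    -- The coordinate of an axis vanishes on all the others but has linear coefficient 1 on its own.
    have hmem : (coord j : axesAlgebra L J) ∈ axisIdeal L j ⊔ origin L J ^ 2 := by
      refine hle (Ideal.mem_inf.2 ⟨coord_mem_origin j, ?_⟩)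
      simp only [Ideal.mem_iInf]
      rintro _ ⟨⟨i, rfl⟩, hne⟩
      exact Ideal.mem_sup_left (coord_mem_axisIdeal (by rintro rfl; exact hne rfl))
    obtain ⟨a, ha, b, hb, hab⟩ := Submodule.mem_sup.1 hmem
    have h1 := congrArg (fun f => (proj j f).coeff 1) hab
    simp only [map_add, mem_axisIdeal.1 ha, zero_add, coeff_one_proj_of_mem_sq hb,
      proj_coord_self, Polynomial.coeff_X_one] at h1
    exact zero_ne_one h1
  embDim_eq := by
    rw [minimalPrimes_eq, finrank_cotangent, ← Set.image_univ,
      Set.ncard_image_of_injective _ axisIdeal_injective, Set.ncard_univ, Nat.card_eq_fintype_card]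

end axesAlgebra

/-- The union of coordinate axes over a finite extension of `K` is a scheme of axes over `K`. -/
lemma isRingOfAxes_axesAlgebra (K L J : Type u) [Field K] [Field L] [Algebra K L]
    [Module.Finite K L] [Fintype J] [Nonempty J] : IsRingOfAxes K (axesAlgebra L J) := by
  classical
  exact
  { finiteType := axesAlgebra.finiteType K
    isReduced := isReduced_of_injective (axesAlgebra L J).val Subtype.val_injective
    dim_eq_one := axesAlgebra.ringKrullDim_eq_one
    normal := by
      rw [axesAlgebra.minimalPrimes_eq]
      rintro _ ⟨j, rfl⟩
      exact axesAlgebra.isIntegrallyClosed_quotient j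
    exists_origin := ⟨_, axesAlgebra.isOriginOfAxes⟩ }

end ModelAxes

/-! ### Generators of primary monomial ideals and integral supporting weights. -/

section Weights

variable {m : ℕ} {K : Type u} [Field K] {I : Ideal (MvPolynomial (Fin m) K)}

lemma isUpperSet_exponentSet : IsUpperSet (exponentSet I) := by
  intro γ δ hle hγ
  have h : monomial δ (1 : K) = monomial (δ - γ) 1 * monomial γ 1 := by
    rw [monomial_mul, one_mul, tsub_add_cancel_of_le hle]
  change monomial δ (1 : K) ∈ I
  rw [h]
  exact I.mul_mem_left _ hγ

/-- A primary monomial ideal is generated by finitely many monomials in some of the variables, among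
them a power of each of these variables. -/
lemma exists_generators_of_isPrimary (hmon : IsMonomialIdeal I) (hprim : I.IsPrimary) :
    ∃ (A : Set (Fin m)) (F : Finset (Fin m →₀ ℕ)),
      I = Ideal.span ((fun γ => monomial γ (1 : K)) '' F) ∧ 0 ∉ F ∧
      (∀ γ ∈ F, ∀ i ∉ A, γ i = 0) ∧ ∀ i ∈ A, ∃ γ ∈ F, ∀ j, j ≠ i → γ j = 0 := by
  classical
  have hprim' := Ideal.isPrimary_iff.1 hprim
  have hrad : I.radical.IsPrime := Ideal.isPrime_radical hprim
  let A : Set (Fin m) := {i | (X i : MvPolynomial (Fin m) K) ∈ I.radical}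
  let S : Set (Fin m →₀ ℕ) := {γ | γ ∈ exponentSet I ∧ ∀ i ∉ A, γ i = 0}
  -- The factor in the variables outside `A` is not in the prime radical, so primariness lets it be
  -- cancelled.
  have hrestrict : ∀ γ ∈ exponentSet I, γ.filter (· ∈ A) ∈ S := by
    intro γ hγ
    refine ⟨?_, fun i hi => Finsupp.filter_apply_neg _ _ hi⟩
    have h : monomial γ (1 : K) =
        monomial (γ.filter (· ∈ A)) 1 * monomial (γ.filter (¬ · ∈ A)) 1 := by
      rw [monomial_mul, one_mul, Finsupp.filter_add_filter_not]
    have hmem : monomial γ (1 : K) ∈ I := hγ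
    rw [h] at hmem
    refine (hprim'.2 hmem).resolve_right fun hr => ?_
    rw [monomial_eq, C_1, one_mul, Finsupp.prod, hrad.prod_mem_iff] at hr
    obtain ⟨i, hi, hir⟩ := hr
    have hiA : i ∈ A := hrad.mem_of_pow_mem _ hir
    rw [Finsupp.mem_support_iff] at hi
    exact hi (Finsupp.filter_apply_neg _ _ (not_not.2 hiA))
  have hIS : I = Ideal.span ((fun γ => monomial γ (1 : K)) '' S) := by
    obtain ⟨S₀, hS₀⟩ := hmon
    refine le_antisymm ?_ (Ideal.span_le.2 ?_)
    · conv_lhs => rw [hS₀]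
      refine Ideal.span_le.2 ?_
      rintro _ ⟨γ, hγ, rfl⟩
      have hγI : γ ∈ exponentSet I := by
        change monomial γ (1 : K) ∈ I
        rw [hS₀]
        exact Ideal.subset_span ⟨γ, hγ, rfl⟩
      have h : monomial γ (1 : K) =
          monomial (γ.filter (¬ · ∈ A)) 1 * monomial (γ.filter (· ∈ A)) 1 := by
        rw [monomial_mul, one_mul, add_comm, Finsupp.filter_add_filter_not]
      simp only [SetLike.mem_coe]
      rw [h]
      exact Ideal.mul_mem_left _ _ (Ideal.subset_span ⟨_, hrestrict γ hγI, rfl⟩)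
    · rintro _ ⟨γ, hγ, rfl⟩
      exact hγ.1
  obtain ⟨s, hsS, hs⟩ := (Submodule.fg_span_iff_fg_span_finset_subset _).1
    (hIS ▸ IsNoetherian.noetherian I :
      (Ideal.span ((fun γ => monomial γ (1 : K)) '' S)).FG)
  obtain ⟨F, hFS, rfl⟩ := Finset.subset_set_image_iff.1 hsS
  have hF : I = Ideal.span ((fun γ => monomial γ (1 : K)) '' F) := by
    rw [Finset.coe_image] at hs
    exact hIS.trans hs
  have h0 : (0 : Fin m →₀ ℕ) ∉ F := by
    intro h
    refine hprim'.1 ((Ideal.eq_top_iff_one _).2 ?_)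
    exact (hFS h).1
  refine ⟨A, F, hF, h0, fun γ hγ => (hFS hγ).2, fun i hi => ?_⟩
  obtain ⟨n, hn⟩ := hi
  rw [X_pow_eq_monomial, hF, mem_ideal_span_monomial_image] at hn
  obtain ⟨γ, hγ, hle⟩ := hn (Finsupp.single i n) (by simp [support_monomial])
  refine ⟨γ, hγ, fun j hj => ?_⟩
  simpa [hj] using hle j

/-- A lattice point that is not interior to the convex hull of the exponents is minimal for some
integral weight that is positive exactly on the variables in the radical. -/
lemma exists_nat_weight {A : Set (Fin m)} {F : Finset (Fin m →₀ ℕ)}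
    (hI : I = Ideal.span ((fun γ => monomial γ (1 : K)) '' F)) (hF0 : 0 ∉ F)
    (hFA : ∀ γ ∈ F, ∀ i ∉ A, γ i = 0) (hA : ∀ i ∈ A, ∃ γ ∈ F, ∀ j, j ≠ i → γ j = 0)
    {τ : Fin m →₀ ℕ} (hτ : realPoint τ ∉ exponentHullInterior I) :
    ∃ w : Fin m → ℕ, (∀ i, w i ≠ 0 ↔ i ∈ A) ∧
      ∀ γ ∈ F, ∑ i, τ i * w i ≤ ∑ i, γ i * w i := by
  classical
  rw [realPoint_mem_exponentHullInterior_iff] at hτ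
  have hFΓ : (F : Set (Fin m →₀ ℕ)) ⊆ exponentSet I := fun γ hγ => by
    change monomial γ (1 : K) ∈ I
    rw [hI]
    exact Ideal.subset_span ⟨γ, hγ, rfl⟩
  obtain ⟨w, hw0, hwA, hwF, hwτ⟩ := exists_weight_of_not_interior isUpperSet_exponentSet
    F.finite_toSet hFΓ hF0 hFA hτ
  have hwpos : ∀ i ∈ A, 0 < w i := by
    intro i hi
    obtain ⟨γ, hγ, hγi⟩ := hA i hi
    have h := hwF γ hγ
    rw [Finset.sum_eq_single i (fun j _ hj => by simp [hγi j hj]) (by simp)] at h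
    refine (hw0 i).lt_of_ne fun h0 => ?_
    rw [← h0, Pi.zero_apply, mul_zero] at h
    linarith
  -- Unit vectors preserve the zero pattern of `w`; the differences `γ - τ` preserve the comparison
  -- of weights.
  obtain ⟨q, hq⟩ := exists_int_sign_eq w
    (B := (Set.range fun i => Pi.single i 1) ∪ (fun (γ : Fin m →₀ ℕ) i => (γ i : ℤ) - τ i) '' F)
    ((Set.finite_range _).union (F.finite_toSet.image _))
  have hqi : ∀ i, SignType.sign (q i) = SignType.sign (w i) := by
    intro i
    have h := hq (Pi.single i 1) (Or.inl ⟨i, rfl⟩)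
    rw [Finset.sum_eq_single i (fun j _ hj => by simp [hj]) (by simp),
      Finset.sum_eq_single i (fun j _ hj => by simp [hj]) (by simp)] at h
    simpa using h
  have hq0 : ∀ i, 0 ≤ q i := fun i => by
    rw [← sign_nonneg_iff, hqi, sign_nonneg_iff]
    exact hw0 i
  refine ⟨fun i => (q i).toNat, fun i => ⟨fun h => ?_, fun h => ?_⟩, fun γ hγ => ?_⟩
  · by_contra hi
    have h1 := hqi i
    rw [hwA i hi, sign_zero, sign_eq_zero_iff] at h1
    simp [h1] at h
  · have h1 := hqi i
    rw [sign_pos (hwpos i h), sign_eq_one_iff] at h1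
    simp only
    omega
  · have h := hq _ (Or.inr ⟨γ, hγ, rfl⟩)
    have hge : (0 : ℝ) ≤ ∑ i, (((γ i : ℤ) - τ i : ℤ) : ℝ) * w i := by
      have h2 : ∑ i, (((γ i : ℤ) - τ i : ℤ) : ℝ) * w i =
          ∑ i, (γ i : ℝ) * w i - ∑ i, (τ i : ℝ) * w i := by
        rw [← Finset.sum_sub_distrib]
        exact Finset.sum_congr rfl fun i _ => by push_cast; ring
      rw [h2]
      linarith [hwF γ hγ]
    rw [← sign_nonneg_iff, ← h, sign_nonneg_iff] at hge
    have h3 : ∑ i, ((γ i : ℤ) - τ i) * q i = ∑ i, (γ i : ℤ) * q i - ∑ i, (τ i : ℤ) * q i := by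
      rw [← Finset.sum_sub_distrib]
      exact Finset.sum_congr rfl fun i _ => by ring
    rw [h3] at hge
    zify
    simp only [Int.toNat_of_nonneg (hq0 _)]
    linarith

end Weights

/-! ### Grids, specialization of variables, and monomial curves. -/

section Evaluation

/-- A field has finite extensions with arbitrarily many elements. -/
lemma exists_finite_extension_card_lt (K : Type u) [Field K] (d : ℕ) :
    ∃ (L : Type u) (_ : Field L) (_ : Algebra K L), Module.Finite K L ∧
      ∃ S : Finset L, d < S.card := by
  classical
  obtain ⟨S, hS⟩ := Infinite.exists_subset_card_eq (AlgebraicClosure K) (d + 1)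
  let L := IntermediateField.adjoin K (S : Set (AlgebraicClosure K))
  refine ⟨L, inferInstance, inferInstance, ?_, S.attach.image fun s =>
    ⟨s.1, IntermediateField.subset_adjoin K _ s.2⟩, ?_⟩
  · exact IntermediateField.finiteDimensional_adjoin fun x _ =>
      Algebra.IsIntegral.isIntegral x
  · rw [Finset.card_image_of_injective, Finset.card_attach, hS]
    · exact Nat.lt_succ_self d
    · intro s t h
      exact Subtype.ext (Subtype.mk.inj h)

variable {m : ℕ} {L : Type*} [Field L]

/-- A nonzero polynomial does not vanish on a sufficiently large finite grid. -/
lemma exists_eval_ne_zero_of_lt_card {p : MvPolynomial (Fin m) L} (hp : p ≠ 0) {d : ℕ}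
    (hd : ∀ τ ∈ p.support, ∀ i, τ i ≤ d) {S : Finset L} (hS : d < S.card) :
    ∃ x : Fin m → S, eval (fun i => (x i : L)) p ≠ 0 := by
  by_contra! h
  refine hp (eq_zero_of_eval_zero_at_prod_finset p (fun _ => S) (fun i => ?_) fun x hx => ?_)
  · rw [degreeOf_lt_iff (by omega)]
    exact fun τ hτ => (hd τ hτ i).trans_lt hS
  · exact h fun i => ⟨x i, hx i⟩

open Classical in
/-- Specialization of the variables outside of `A`. -/
noncomputable def specialize (A : Set (Fin m)) (μ : Fin m → L) :
    MvPolynomial (Fin m) L →ₐ[L] MvPolynomial (Fin m) L :=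
  aeval fun i => if i ∈ A then X i else C (μ i)

open Classical in
lemma specialize_monomial (A : Set (Fin m)) (μ : Fin m → L) (τ : Fin m →₀ ℕ) (c : L) :
    specialize A μ (monomial τ c) =
      monomial (τ.filter (· ∈ A)) (c * ∏ i, if i ∈ A then 1 else μ i ^ τ i) := by
  have h1 : monomial (τ.filter (· ∈ A)) (1 : L) = ∏ i, if i ∈ A then X i ^ τ i else 1 := by
    rw [monomial_eq, C_1, one_mul, Finsupp.prod_fintype _ _ (fun i => pow_zero _)]
    refine Finset.prod_congr rfl fun i _ => ?_
    by_cases h : i ∈ A <;> simp [h]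
  rw [specialize, aeval_monomial, Finsupp.prod_fintype _ _ (fun i => pow_zero _),
    ← mul_one (c * _), ← C_mul_monomial, h1, C_mul, map_prod, mul_assoc, ← Finset.prod_mul_distrib,
    algebraMap_eq]
  congr 1
  refine Finset.prod_congr rfl fun i _ => ?_
  by_cases h : i ∈ A <;> simp [h]

open Classical in
-- Monomials that agree on `A` merge and may cancel, so only this direction holds.
lemma exists_of_mem_support_specialize {A : Set (Fin m)} {μ : Fin m → L}
    {p : MvPolynomial (Fin m) L} {α : Fin m →₀ ℕ} (hα : α ∈ (specialize A μ p).support) :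
    ∃ τ ∈ p.support, α = τ.filter (· ∈ A) := by
  rw [as_sum p, map_sum] at hα
  obtain ⟨τ, hτ, h⟩ := Finset.mem_biUnion.1 (support_sum hα)
  rw [specialize_monomial] at h
  exact ⟨τ, hτ, Finset.mem_singleton.1 (support_monomial_subset h)⟩

/-- Ensures that specializing at a point where the polynomial is nonzero gives a nonzero polynomial.
-/
lemma eval_specialize (A : Set (Fin m)) (μ : Fin m → L) (p : MvPolynomial (Fin m) L) :
    eval μ (specialize A μ p) = eval μ p := by
  have h : (aeval μ : MvPolynomial (Fin m) L →ₐ[L] L).comp (specialize A μ) = aeval μ := by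
    refine algHom_ext fun i => ?_
    by_cases h : i ∈ A <;> simp [specialize, h]
  simpa [aeval_eq_eval] using DFunLike.congr_fun h p

/-- The monomial curve with the given coefficients and weights. -/
noncomputable def curve (w : Fin m → ℕ) (x : Fin m → L) :
    MvPolynomial (Fin m) L →ₐ[L] Polynomial L :=
  aeval fun i => Polynomial.C (x i) * Polynomial.X ^ w i

lemma curve_monomial (w : Fin m → ℕ) (x : Fin m → L) (τ : Fin m →₀ ℕ) (c : L) :
    curve w x (monomial τ c) =
      Polynomial.C (eval x (monomial τ c)) * Polynomial.X ^ ∑ i, τ i * w i := by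
  rw [curve, aeval_monomial, eval_monomial, Finsupp.prod_fintype _ _ (fun i => pow_zero _),
    Finsupp.prod_fintype _ _ (fun i => pow_zero _), ← Finset.prod_pow_eq_pow_sum,
    Polynomial.C_mul, map_prod, mul_assoc, ← Finset.prod_mul_distrib, Polynomial.algebraMap_eq]
  congr 1
  refine Finset.prod_congr rfl fun i _ => ?_
  rw [mul_pow, Polynomial.C_pow, mul_comm (τ i), pow_mul]

/-- The part of a polynomial of a given weight. -/
noncomputable def weightPart (w : Fin m → ℕ) (n : ℕ) (p : MvPolynomial (Fin m) L) :
    MvPolynomial (Fin m) L :=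
  ∑ τ ∈ p.support with ∑ i, τ i * w i = n, monomial τ (coeff τ p)

lemma coeff_weightPart (w : Fin m → ℕ) (n : ℕ) (p : MvPolynomial (Fin m) L) (α : Fin m →₀ ℕ) :
    coeff α (weightPart w n p) = if ∑ i, α i * w i = n then coeff α p else 0 := by
  classical
  rw [weightPart, coeff_sum]
  simp only [coeff_monomial, Finset.sum_ite_eq', Finset.mem_filter, mem_support_iff]
  by_cases h1 : coeff α p = 0 <;> by_cases h2 : ∑ i, α i * w i = n <;> simp [h1, h2]

lemma coeff_curve (w : Fin m → ℕ) (x : Fin m → L) (p : MvPolynomial (Fin m) L) (n : ℕ) :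
    (curve w x p).coeff n = eval x (weightPart w n p) := by
  conv_lhs => rw [as_sum p]
  rw [weightPart, map_sum, map_sum, Polynomial.finsetSum_coeff, Finset.sum_filter]
  refine Finset.sum_congr rfl fun τ _ => ?_
  rw [curve_monomial, Polynomial.coeff_C_mul, Polynomial.coeff_X_pow]
  by_cases h : ∑ i, τ i * w i = n
  · simp [h]
  · simp [h, Ne.symm h]

end Evaluation

/-! ### Monomials outside the ideal and the interior are not in the closure. -/

section BoundaryMonomials

variable {m : ℕ} {K : Type u} [Field K]

open Classical in
/-- The family of monomial curves with coefficients in a finite set, as a map to the union of axes.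
The variables outside of `A` are specialized. -/
noncomputable def curveFamily {L : Type u} [Field L] [Algebra K L] (S : Finset L)
    (A : Set (Fin m)) (μ : Fin m → L) (w : Fin m → ℕ) (hw : ∀ i ∈ A, w i ≠ 0) :
    MvPolynomial (Fin m) K →ₐ[K] axesAlgebra L (Fin m → S) :=
  aeval fun i => ⟨fun x => if i ∈ A then Polynomial.C (x i : L) * Polynomial.X ^ w i
    else Polynomial.C (μ i), fun x y => by
      by_cases h : i ∈ A
      · simp [h, (hw i h).symm]
      · simp [h]⟩

lemma proj_curveFamily {L : Type u} [Field L] [Algebra K L] {S : Finset L}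
    {A : Set (Fin m)} {μ : Fin m → L} {w : Fin m → ℕ} (hw : ∀ i ∈ A, w i ≠ 0) (x : Fin m → S)
    (f : MvPolynomial (Fin m) K) :
    axesAlgebra.proj x (curveFamily S A μ w hw f) =
      curve w (fun i => (x i : L)) (specialize A μ (map (algebraMap K L) f)) := by
  have h : ((axesAlgebra.proj x).restrictScalars K).comp (curveFamily S A μ w hw) =
      (((curve w fun i => (x i : L)).comp (specialize A μ)).restrictScalars K).comp
        (mapAlgHom (Algebra.ofId K L)) := by
    refine algHom_ext fun i => ?_
    by_cases hi : i ∈ A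
    · simp [hi, curveFamily, axesAlgebra.proj_apply, specialize, curve]
    · simp [hi, curveFamily, axesAlgebra.proj_apply, specialize, curve]
  exact DFunLike.congr_fun h f

/-- The lowest coefficients of the elements of the ideal generated by images of monomials under a
family of monomial curves are the values of a linear combination of these monomials. -/
lemma exists_coeff_eq_eval_of_mem_span {L J : Type*} [Field L] [Nonempty J]
    (w : Fin m → ℕ) (x : J → Fin m → L) {F : Set (Fin m →₀ ℕ)} {c : ℕ}
    (hc : ∀ γ ∈ F, c ≤ ∑ i, γ i * w i) {B : Set (axesAlgebra L J)}
    (hB : ∀ b ∈ B, ∃ γ ∈ F, ∀ j, axesAlgebra.proj j b = curve w (x j) (monomial γ 1))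
    {t : axesAlgebra L J} (ht : t ∈ Ideal.span B) :
    (∀ j, Polynomial.X ^ c ∣ axesAlgebra.proj j t) ∧
      ∃ h : MvPolynomial (Fin m) L, (∀ α ∉ F, coeff α h = 0) ∧
        ∀ j, (axesAlgebra.proj j t).coeff c = eval (x j) h := by
  classical
  induction ht using Submodule.span_induction with
  | mem b hb =>
    obtain ⟨γ, hγ, hbγ⟩ := hB b hb
    refine ⟨fun j => ?_, weightPart w c (monomial γ 1), fun α hα => ?_, fun j => ?_⟩
    · rw [hbγ, curve_monomial]
      exact Dvd.dvd.mul_left (pow_dvd_pow _ (hc γ hγ)) _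
    · have hne : γ ≠ α := fun h => hα (h ▸ hγ)
      rw [coeff_weightPart, coeff_monomial, if_neg hne, ite_self]
    · rw [hbγ, coeff_curve]
  | zero => exact ⟨fun j => by simp, 0, by simp, by simp⟩
  | add s t _ _ hs ht =>
    obtain ⟨hs, g, hg, hg'⟩ := hs
    obtain ⟨ht, h, hh, hh'⟩ := ht
    refine ⟨fun j => by rw [map_add]; exact dvd_add (hs j) (ht j), g + h, fun α hα => ?_,
      fun j => ?_⟩
    · rw [coeff_add, hg α hα, hh α hα, add_zero]
    · rw [map_add, Polynomial.coeff_add, hg', hh', map_add]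
  | smul a t _ ht =>
    obtain ⟨ht, h, hh, hh'⟩ := ht
    let j₀ : J := Classical.arbitrary J
    refine ⟨fun j => by rw [smul_eq_mul, map_mul]; exact (ht j).mul_left _,
      C ((axesAlgebra.proj j₀ a).coeff 0) * h, fun α hα => ?_, fun j => ?_⟩
    · rw [coeff_C_mul, hh α hα, mul_zero]
    -- Since `X ^ c` divides `t` on each axis, multiplying by `a` scales the lowest coefficient by
    -- the value of `a` at the origin, the same scalar on all axes.
    · rw [map_mul, eval_C, ← hh' j, smul_eq_mul, map_mul, axesAlgebra.coeff_zero_proj a j₀ j]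
      obtain ⟨r, hr⟩ := ht j
      have hcoeff : ∀ q : Polynomial L, (Polynomial.X ^ c * q).coeff c = q.coeff 0 := fun q => by
        simpa using Polynomial.coeff_X_pow_mul q c 0
      rw [hr, mul_left_comm, hcoeff, hcoeff, Polynomial.mul_coeff_zero]

/-- A polynomial in the axes closure of a primary monomial ideal vanishes if none of its monomials
lies in the ideal or is interior to the convex hull. -/
lemma eq_zero_of_mem_axesClosure {I : Ideal (MvPolynomial (Fin m) K)} (hmon : IsMonomialIdeal I)
    (hprim : I.IsPrimary) {f : MvPolynomial (Fin m) K} (hf : f ∈ axesClosure K I)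
    (hI : ∀ τ ∈ f.support, τ ∉ exponentSet I)
    (hint : ∀ τ ∈ f.support, realPoint τ ∉ exponentHullInterior I) : f = 0 := by
  classical
  by_contra hf0
  obtain ⟨A, F, hIF, hF0, hFA, hA⟩ := exists_generators_of_isPrimary hmon hprim
  -- The bound covers `F` as well, because the combination of generators to be compared with `f` is
  -- supported there.
  obtain ⟨d, hd⟩ : ∃ d, ∀ τ ∈ f.support ∪ F, ∀ i, τ i ≤ d :=
    ⟨(f.support ∪ F).sup fun τ => Finset.univ.sup τ, fun τ hτ i =>
      (Finset.le_sup (f := τ) (Finset.mem_univ i)).trans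
        (Finset.le_sup (f := fun τ : Fin m →₀ ℕ => Finset.univ.sup τ) hτ)⟩
  obtain ⟨L, _, _, _, S, hS⟩ := exists_finite_extension_card_lt K d
  set p := map (algebraMap K L) f with hp
  have hpf : p.support = f.support := support_map_of_injective _ (algebraMap K L).injective
  have hp0 : p ≠ 0 := by
    rw [← support_nonempty, hpf, support_nonempty]
    exact hf0
  obtain ⟨μ', hμ⟩ := exists_eval_ne_zero_of_lt_card hp0
    (fun τ hτ => hd τ (Finset.mem_union_left _ (hpf ▸ hτ))) hS
  set μ : Fin m → L := fun i => μ' i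
  set q := specialize A μ p with hq
  have hq0 : q ≠ 0 := fun h => hμ (by rw [← eval_specialize A, ← hq, h, map_zero])
  have hqsupp : ∀ α ∈ q.support, ∃ τ ∈ f.support, α = τ.filter (· ∈ A) := fun α hα => by
    rw [← hpf]
    exact exists_of_mem_support_specialize hα
  obtain ⟨α₀, hα₀⟩ := support_nonempty.2 hq0
  obtain ⟨τ₀, hτ₀, rfl⟩ := hqsupp α₀ hα₀
  obtain ⟨w, hwA, hwF⟩ := exists_nat_weight hIF hF0 hFA hA (hint τ₀ hτ₀)
  -- The exponent `β` of least weight need not come from `τ₀`, but its weight is at most that of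
  -- `τ₀`, hence at most that of each generator.
  obtain ⟨β, hβ, hmin⟩ := q.support.exists_min_image (fun α => ∑ i, α i * w i) ⟨_, hα₀⟩
  set c := ∑ i, β i * w i with hc
  have hcF : ∀ γ ∈ F, c ≤ ∑ i, γ i * w i := by
    intro γ hγ
    refine ((hmin _ hα₀).trans (Finset.sum_le_sum fun i _ => ?_)).trans (hwF γ hγ)
    refine Nat.mul_le_mul_right _ ?_
    rw [Finsupp.filter_apply]
    split_ifs <;> simp
  have hne : Nonempty S := (Finset.card_pos.1 (by omega : 0 < S.card)).to_subtype
  have hwA' : ∀ i ∈ A, w i ≠ 0 := fun i => (hwA i).2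
  have hmem := hf (axesAlgebra L (Fin m → S)) (isRingOfAxes_axesAlgebra K L (Fin m → S))
    (curveFamily S A μ w hwA').toRingHom
  rw [hIF, Ideal.map_span] at hmem
  obtain ⟨-, h, hhF, hh⟩ := exists_coeff_eq_eval_of_mem_span (F := F) w
    (fun (x : Fin m → S) i => (x i : L)) hcF (by
      rintro _ ⟨_, ⟨γ, hγ, rfl⟩, rfl⟩
      refine ⟨γ, hγ, fun x => ?_⟩
      have hγA : γ.filter (· ∈ A) = γ := by
        ext i
        by_cases hi : i ∈ A
        · rw [Finsupp.filter_apply_pos _ _ hi]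
        · rw [Finsupp.filter_apply_neg _ _ hi, hFA γ hγ i hi]
      have hprod : ∏ i, (if i ∈ A then 1 else μ i ^ γ i) = 1 :=
        Finset.prod_eq_one fun i _ => by
          by_cases hi : i ∈ A
          · simp [hi]
          · simp [hi, hFA γ hγ i hi]
      refine (proj_curveFamily hwA' x _).trans ?_
      rw [map_monomial, map_one, specialize_monomial, hγA, hprod, mul_one]) hmem
  have heq : ∀ x : Fin m → S, eval (fun i => (x i : L)) (weightPart w c q - h) = 0 := by
    intro x
    rw [map_sub, ← hh x, ← coeff_curve, sub_eq_zero, hq, hp, ← proj_curveFamily hwA']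
    rfl
  -- Otherwise the exponent of `f` restricting to `β` would dominate a generator and lie in the
  -- exponent set.
  have hβF : β ∉ F := by
    intro hβF
    obtain ⟨τ, hτ, rfl⟩ := hqsupp β hβ
    refine hI τ hτ (isUpperSet_exponentSet (a := τ.filter (· ∈ A)) (fun i => ?_) ?_)
    · rw [Finsupp.filter_apply]
      split_ifs <;> simp
    · change monomial _ (1 : K) ∈ I
      rw [hIF]
      exact Ideal.subset_span ⟨_, hβF, rfl⟩
  have hG0 : weightPart w c q - h ≠ 0 := by
    intro h0
    have h1 := congrArg (coeff β) h0
    rw [coeff_sub, coeff_weightPart, if_pos hc.symm, hhF β hβF, sub_zero, coeff_zero] at h1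
    exact mem_support_iff.1 hβ h1
  obtain ⟨x, hx⟩ := exists_eval_ne_zero_of_lt_card hG0 (d := d) (fun α hα i => by
    by_cases hαF : α ∈ F
    · exact hd α (Finset.mem_union_right _ hαF) i
    · have hαq : α ∈ q.support := by
        rw [mem_support_iff] at hα ⊢
        rw [coeff_sub, hhF α hαF, sub_zero, coeff_weightPart] at hα
        exact fun h0 => hα (by rw [h0, ite_self])
      obtain ⟨τ, hτ, rfl⟩ := hqsupp α hαq
      refine le_trans ?_ (hd τ (Finset.mem_union_left _ hτ) i)
      rw [Finsupp.filter_apply]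
      split_ifs <;> simp) hS
  exact hx (heq x)

end BoundaryMonomials

/-! ### Reduction to single monomials and conclusion. -/

section Main

variable {m : ℕ} {K : Type u} [Field K]

lemma le_axesClosure (I : Ideal (MvPolynomial (Fin m) K)) : I ≤ axesClosure K I :=
  fun _ hf _ _ _ _ φ => Ideal.mem_map_of_mem φ hf

/-- The monomials of an element of the axes closure of a primary monomial ideal lie in the ideal or
are interior to the convex hull. -/
lemma mem_or_mem_interior_of_mem_axesClosure {I : Ideal (MvPolynomial (Fin m) K)}
    (hmon : IsMonomialIdeal I) (hprim : I.IsPrimary) {f : MvPolynomial (Fin m) K}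
    (hf : f ∈ axesClosure K I) {τ : Fin m →₀ ℕ} (hτ : τ ∈ f.support) :
    monomial τ (1 : K) ∈ I ∨ realPoint τ ∈ exponentHullInterior I := by
  classical
  by_contra hbad
  let good : (Fin m →₀ ℕ) → Prop := fun τ =>
    monomial τ (1 : K) ∈ I ∨ realPoint τ ∈ exponentHullInterior I
  -- The closure is not known beforehand to be monomial, so all bad terms are treated at once: they
  -- form an element of the closure, as the good terms already lie in it.
  set g := ∑ σ ∈ f.support with ¬ good σ, monomial σ (coeff σ f) with hg
  have hsum : f = (∑ σ ∈ f.support with good σ, monomial σ (coeff σ f)) + g := by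
    rw [hg, Finset.sum_filter_add_sum_filter_not, ← as_sum]
  have hgmem : g ∈ axesClosure K I := by
    have hgood : (∑ σ ∈ f.support with good σ, monomial σ (coeff σ f)) ∈ axesClosure K I := by
      refine Ideal.sum_mem _ fun σ hσ => ?_
      rw [← mul_one (coeff σ f), ← C_mul_monomial]
      refine Ideal.mul_mem_left _ _ ?_
      rcases (Finset.mem_filter.1 hσ).2 with h | h
      · exact le_axesClosure I h
      · exact monomial_mem_axesClosure_of_mem_interior h
    rw [hsum] at hf
    exact (Ideal.add_mem_iff_right _ hgood).1 hf
  have hcoeff : ∀ σ, coeff σ g = if good σ then 0 else coeff σ f := by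
    intro σ
    rw [hg, coeff_sum]
    simp only [coeff_monomial, Finset.sum_ite_eq', Finset.mem_filter, mem_support_iff]
    by_cases h1 : coeff σ f = 0 <;> by_cases h2 : good σ <;> simp [h1, h2]
  have hgsupp : ∀ σ ∈ g.support, ¬ good σ := fun σ hσ h => by
    rw [mem_support_iff, hcoeff, if_pos h] at hσ
    exact hσ rfl
  have hg0 := eq_zero_of_mem_axesClosure hmon hprim hgmem
    (fun σ hσ h => hgsupp σ hσ (Or.inl h)) (fun σ hσ h => hgsupp σ hσ (Or.inr h))
  have h1 := hcoeff τ
  rw [hg0, coeff_zero, if_neg hbad] at h1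
  exact mem_support_iff.1 hτ h1.symm

end Main

theorem theorem4p5 {K : Type u} [Field K] (m : ℕ) (I : Ideal (MvPolynomial (Fin m) K))
    (hmon : IsMonomialIdeal I) (hprim : I.IsPrimary) :
    axesClosure K I =
        I ⊔ Ideal.span
          ((fun τ => monomial τ (1 : K)) '' {τ | realPoint τ ∈ exponentHullInterior I}) ∧
      (∀ τ : Fin m →₀ ℕ, monomial τ (1 : K) ∈ axesClosure K I ↔
        monomial τ (1 : K) ∈ I ∨ realPoint τ ∈ exponentHullInterior I) ∧
      (∀ τ : Fin m →₀ ℕ, realPoint τ ∈ exponentHull I \ exponentHullInterior I →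
        monomial τ (1 : K) ∉ I → monomial τ (1 : K) ∉ axesClosure K I) := by
  have key : ∀ τ : Fin m →₀ ℕ, monomial τ (1 : K) ∈ axesClosure K I →
      monomial τ (1 : K) ∈ I ∨ realPoint τ ∈ exponentHullInterior I := fun τ h =>
    mem_or_mem_interior_of_mem_axesClosure hmon hprim h (by simp)
  refine ⟨le_antisymm (fun f hf => ?_) (sup_le (le_axesClosure I) (Ideal.span_le.2 ?_)),
    fun τ => ⟨key τ, ?_⟩, fun τ hτ hτI h => (key τ h).elim hτI hτ.2⟩
  · rw [as_sum f]
    refine Ideal.sum_mem _ fun τ hτ => ?_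
    rw [← mul_one (coeff τ f), ← C_mul_monomial]
    refine Ideal.mul_mem_left _ _ ?_
    rcases mem_or_mem_interior_of_mem_axesClosure hmon hprim hf hτ with h | h
    · exact Ideal.mem_sup_left h
    · exact Ideal.mem_sup_right (Ideal.subset_span ⟨τ, h, rfl⟩)
  · rintro _ ⟨τ, hτ, rfl⟩
    exact monomial_mem_axesClosure_of_mem_interior hτ
  · rintro (h | h)
    · exact le_axesClosure I h
    · exact monomial_mem_axesClosure_of_mem_interior h
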